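/- Let $\rho,\sigma$ be quantum states on a separable complex Hilbert space $\mathcal H$ (positive semi-definite operators of trace one), let $p\in(0,1)$, $q=1-p$ and $\varepsilon\in[0,1]$. For $n\in\mathbb N=\{1,2,\dots\}$ let $$p_e(n)=\inf_{0\le\Lambda\le I}\big\{p\operatorname{Tr}[(I-\Lambda)\rho^{\otimes n}]+q\operatorname{Tr}[\Lambda\sigma^{\otimes n}]\big\}$$ (infimum over operators $\Lambda$ on $\mathcal H^{\otimes n}$) and let $n^*=n^*(p,\rho,q,\sigma,\varepsilon)=\inf\{n\in\mathbb N: p_e(n)\le\varepsilon\}\in\mathbb N\cup\{\infty\}$ be the sample complexity of symmetric binary quantum hypothesis testing. Write $\|A\|_r=(\operatorname{Tr}[(A^\dagger A)^{r/2}])^{1/r}$, $F(\rho,\sigma)=\|\sqrt\rho\sqrt\sigma\|_1^2$ and $d_{\mathrm B}(\rho,\sigma)=\inf_U\|\sqrt\rho-U\sqrt\sigma\|_2$, with $U$ ranging over the unitary operators. Assume that none of the following trivial conditions holds: (i) $\rho\sigma=0$; (ii) $\varepsilon\in[1/2,1]$; (iii) $\varepsilon\ge p^sq^{1-s}$ for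 some $s\in[0,1]$; (iv) $\rho=\sigma$ and $\min\{p,q\}>\varepsilon\in[0,1/2)$. Then $$\max\left\{\frac{\ln(pq/\varepsilon)}{-\ln F(\rho,\sigma)},\ \frac{pq-\varepsilon(1-\varepsilon)}{pq\,[d_{\mathrm B}(\rho,\sigma)]^2}\right\}\ \le\ n^*(p,\rho,q,\sigma,\varepsilon)\ \le\ \left\lceil\inf_{s\in[0,1]}\frac{\ln\!\big(p^sq^{1-s}/\varepsilon\big)}{-\ln\operatorname{Tr}[\rho^s\sigma^{1-s}]}\right\rceil .$$ Here, for $\varepsilon=0$, the logarithms in the numerators are $+\infty$; the last quotient is $+\infty$ where its denominator vanishes; $\rho^0=\sigma^0=I$; and $\lceil\infty\rceil=\infty$. -/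

import Mathlib

open scoped InnerProductSpace ENNReal NNReal TensorProduct

noncomputable section

namespace QHT

universe u v

/-! ### Traces, Schatten norms and states -/

section Trace

variable {H : Type u} [NormedAddCommGroup H] [InnerProductSpace ℂ H] [CompleteSpace H]

/-- The index set of a chosen orthonormal (Hilbert) basis of `H`. -/
def basisIndex (H : Type u) [NormedAddCommGroup H] [InnerProductSpace ℂ H] [CompleteSpace H] :
    Set H :=
  (exists_hilbertBasis ℂ H).choose

/-- A chosen orthonormal (Hilbert) basis of `H`. The sums below do not depend on the choice. -/
def basis (H : Type u) [NormedAddCommGroup H] [InnerProductSpace ℂ H] [CompleteSpace H] :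
    HilbertBasis (basisIndex H) ℂ H :=
  (exists_hilbertBasis ℂ H).choose_spec.choose

/-- The trace `Tr[T] = ∑ᵢ ⟨eᵢ, T eᵢ⟩` of a trace-class operator. -/
def trace (T : H →L[ℂ] H) : ℂ :=
  ∑' i, ⟪basis H i, T (basis H i)⟫_ℂ

/-- The trace, in `[0, ∞]`, of an arbitrary positive semi-definite bounded operator. -/
def posTrace (T : H →L[ℂ] H) : ℝ≥0∞ :=
  ∑' i, ENNReal.ofReal (⟪basis H i, T (basis H i)⟫_ℂ).re

/-- The Schatten `r`-norm `‖A‖_r = (Tr[(A† A)^{r/2}])^{1/r}`, with value `∞` when `A` is not in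
the Schatten class. -/
def schattenNorm (r : ℝ) (A : H →L[ℂ] H) : ℝ≥0∞ :=
  (posTrace ((star A * A) ^ (r / 2))) ^ (1 / r)

/-- Quantum states (density operators): positive semi-definite operators of trace one.
As the terms of the sum are nonnegative, `trace ρ = 1` says that the sum converges to `1`. -/
structure IsState (ρ : H →L[ℂ] H) : Prop where
  nonneg : 0 ≤ ρ
  trace_eq_one : trace ρ = 1

/-- The quantum fidelity `F(ρ, σ) = ‖√ρ √σ‖₁²`. -/
def fidelity (ρ σ : H →L[ℂ] H) : ℝ :=
  (schattenNorm 1 (CFC.sqrt ρ * CFC.sqrt σ)).toReal ^ 2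

/-- The Bures distance `d_B(ρ, σ) = min_U ‖√ρ - U √σ‖₂`, `U` ranging over the unitary operators
(in infinite dimension the minimum is to be read as an infimum). -/
def buresDist (ρ σ : H →L[ℂ] H) : ℝ :=
  (⨅ U : unitary (H →L[ℂ] H), schattenNorm 2 (CFC.sqrt ρ - (U : H →L[ℂ] H) * CFC.sqrt σ)).toReal

end Trace

/-! ### Tensor products of Hilbert spaces and of bounded operators -/

section Tensor

variable {E : Type u} [NormedAddCommGroup E] [InnerProductSpace ℂ E] [CompleteSpace E]
variable {F : Type v} [NormedAddCommGroup F] [InnerProductSpace ℂ F] [CompleteSpace F]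

theorem inner_map_map_eq (A : E →L[ℂ] E) (B : F →L[ℂ] F) (x y : E ⊗[ℂ] F) :
    ⟪TensorProduct.map A.toLinearMap B.toLinearMap x,
      TensorProduct.map A.toLinearMap B.toLinearMap y⟫_ℂ =
    ⟪x, TensorProduct.map (star A * A).toLinearMap (star B * B).toLinearMap y⟫_ℂ := by
  induction x using TensorProduct.induction_on with
  | zero => simp
  | add x₁ x₂ h₁ h₂ => simp only [map_add, inner_add_left, h₁, h₂]
  | tmul a b =>
    induction y using TensorProduct.induction_on with
    | zero => simp
    | add y₁ y₂ h₁ h₂ => simp only [map_add, inner_add_right, h₁, h₂]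
    | tmul c d =>
      simp [ContinuousLinearMap.star_eq_adjoint, ContinuousLinearMap.adjoint_inner_right]

theorem exists_star_mul_self (A : E →L[ℂ] E) :
    ∃ C : E →L[ℂ] E, star C * C = algebraMap ℝ (E →L[ℂ] E) (‖A‖ ^ 2) - star A * A := by
  have h : 0 ≤ algebraMap ℝ (E →L[ℂ] E) (‖A‖ ^ 2) - star A * A :=
    sub_nonneg.mpr CStarAlgebra.star_mul_le_algebraMap_norm_sq
  obtain ⟨C, hC⟩ := CStarAlgebra.nonneg_iff_eq_star_mul_self.mp h
  exact ⟨C, hC.symm⟩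

theorem norm_map_le (A : E →L[ℂ] E) (B : F →L[ℂ] F) (x : E ⊗[ℂ] F) :
    ‖TensorProduct.map A.toLinearMap B.toLinearMap x‖ ≤ ‖A‖ * ‖B‖ * ‖x‖ := by
  obtain ⟨C, hC⟩ := exists_star_mul_self A
  obtain ⟨D, hD⟩ := exists_star_mul_self B
  have h₁ := inner_map_map_eq C (1 : F →L[ℂ] F) x x
  have h₂ := inner_map_map_eq A D x x
  have h₃ := inner_map_map_eq A B x x
  have key : ∀ y : E ⊗[ℂ] F,
      ((‖B‖ ^ 2 : ℝ) : ℂ) •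
        TensorProduct.map (star C * C).toLinearMap (star (1 : F →L[ℂ] F) * 1).toLinearMap y +
      TensorProduct.map (star A * A).toLinearMap (star D * D).toLinearMap y +
      TensorProduct.map (star A * A).toLinearMap (star B * B).toLinearMap y =
        ((‖A‖ ^ 2 * ‖B‖ ^ 2 : ℝ) : ℂ) • y := by
    intro y
    induction y using TensorProduct.induction_on with
    | zero => simp
    | add y₁ y₂ h₁ h₂ =>
      rw [smul_add, ← h₁, ← h₂]
      simp only [map_add, smul_add]
      abel
    | tmul c d =>
      have e₁ : (star C * C) c = ((‖A‖ ^ 2 : ℝ) : ℂ) • c - (star A * A) c := by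
        rw [hC, Complex.coe_smul]
        simp [Algebra.algebraMap_eq_smul_one]
      have e₂ : (star D * D) d = ((‖B‖ ^ 2 : ℝ) : ℂ) • d - (star B * B) d := by
        rw [hD, Complex.coe_smul]
        simp [Algebra.algebraMap_eq_smul_one]
      have e₃ : (star (1 : F →L[ℂ] F) * 1) d = d := by simp
      simp only [TensorProduct.map_tmul, ContinuousLinearMap.coe_coe, e₁, e₂, e₃,
        TensorProduct.sub_tmul, TensorProduct.tmul_sub, ← TensorProduct.smul_tmul',
        TensorProduct.tmul_smul, smul_sub, smul_smul, Complex.ofReal_mul]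
      rw [mul_comm]
      abel
  have h := congrArg (fun y => ⟪x, y⟫_ℂ) (key x)
  have e (c : ℂ) (y : E ⊗[ℂ] F) : ⟪x, c • y⟫_ℂ = c * ⟪x, y⟫_ℂ := inner_smul_right x y c
  have e' (y : E ⊗[ℂ] F) : ⟪y, y⟫_ℂ = ((‖y‖ : ℝ) : ℂ) ^ 2 := inner_self_eq_norm_sq_to_K y
  simp only [inner_add_right, e, ← h₁, ← h₂, ← h₃, e'] at h
  have h' : ‖B‖ ^ 2 * ‖TensorProduct.map C.toLinearMap (1 : F →L[ℂ] F).toLinearMap x‖ ^ 2 +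
      ‖TensorProduct.map A.toLinearMap D.toLinearMap x‖ ^ 2 +
      ‖TensorProduct.map A.toLinearMap B.toLinearMap x‖ ^ 2 =
      ‖A‖ ^ 2 * ‖B‖ ^ 2 * ‖x‖ ^ 2 := by
    exact_mod_cast h
  refine (abs_le_of_sq_le_sq' ?_ (by positivity)).2
  rw [mul_pow, mul_pow, ← h']
  exact le_add_of_nonneg_left (by positivity)

/-- The Hilbert-space tensor product: the completion of the algebraic tensor product with respect
to the inner product `⟨a ⊗ b, c ⊗ d⟩ = ⟨a, c⟩ ⟨b, d⟩`. -/
abbrev HilbertTensor (E : Type u) [NormedAddCommGroup E] [InnerProductSpace ℂ E]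
    (F : Type v) [NormedAddCommGroup F] [InnerProductSpace ℂ F] : Type (max u v) :=
  UniformSpace.Completion (E ⊗[ℂ] F)

/-- The tensor product `A ⊗ B` of bounded operators: the continuous extension to the Hilbert-space
tensor product of the map `a ⊗ b ↦ A a ⊗ B b`. -/
def opTensor (A : E →L[ℂ] E) (B : F →L[ℂ] F) : HilbertTensor E F →L[ℂ] HilbertTensor E F :=
  ((TensorProduct.map A.toLinearMap B.toLinearMap).mkContinuous (‖A‖ * ‖B‖)
    (norm_map_le A B)).completion

end Tensor

/-- A bundled complex Hilbert space. -/
structure HilbertSpace : Type (u + 1) where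
  carrier : Type u
  [normedAddCommGroup : NormedAddCommGroup carrier]
  [innerProductSpace : InnerProductSpace ℂ carrier]
  [completeSpace : CompleteSpace carrier]

attribute [instance] HilbertSpace.normedAddCommGroup HilbertSpace.innerProductSpace
  HilbertSpace.completeSpace

section Power

variable (H : Type u) [NormedAddCommGroup H] [InnerProductSpace ℂ H] [CompleteSpace H]

/-- The tensor power `H^{⊗ n}`: the one-dimensional space `ℂ` for `n = 0`, and
`H^{⊗ (n+1)} = H^{⊗ n} ⊗ H`. -/
def tensorPower : ℕ → HilbertSpace.{u}
  | 0 => ⟨EuclideanSpace ℂ PUnit.{u + 1}⟩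
  | n + 1 => ⟨HilbertTensor (tensorPower n).carrier H⟩

variable {H}

/-- The tensor power `A^{⊗ n}` of a bounded operator. -/
def opPower (A : H →L[ℂ] H) :
    (n : ℕ) → (tensorPower H n).carrier →L[ℂ] (tensorPower H n).carrier
  | 0 => 1
  | n + 1 => opTensor (opPower A n) A

end Power

/-! ### Symmetric binary quantum hypothesis testing -/

section Testing

variable {H : Type u} [NormedAddCommGroup H] [InnerProductSpace ℂ H] [CompleteSpace H]

/-- The expected error probability `p Tr[(I - Λ) ρ^{⊗ n}] + q Tr[Λ σ^{⊗ n}]` of the test `Λ`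
(`Λ` is associated with guessing `ρ`, and `I - Λ` with guessing `σ`). -/
def errorProb (p : ℝ) (ρ : H →L[ℂ] H) (q : ℝ) (σ : H →L[ℂ] H) (n : ℕ)
    (Λ : (tensorPower H n).carrier →L[ℂ] (tensorPower H n).carrier) : ℝ :=
  p * (trace ((1 - Λ) * opPower ρ n)).re + q * (trace (Λ * opPower σ n)).re

/-- The optimal error probability: the infimum over all tests `0 ≤ Λ ≤ I` on `H^{⊗ n}`. -/
def optErrorProb (p : ℝ) (ρ : H →L[ℂ] H) (q : ℝ) (σ : H →L[ℂ] H) (n : ℕ) : ℝ :=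
  ⨅ Λ : {Λ : (tensorPower H n).carrier →L[ℂ] (tensorPower H n).carrier // 0 ≤ Λ ∧ Λ ≤ 1},
    errorProb p ρ q σ n Λ.1

/-- The sample complexity `n*(p, ρ, q, σ, ε) = inf {n ∈ {1, 2, …} : p_e(p, ρ, q, σ, n) ≤ ε}`,
which is `∞` if there is no such `n`. -/
def sampleComplexity (p : ℝ) (ρ : H →L[ℂ] H) (q : ℝ) (σ : H →L[ℂ] H) (ε : ℝ) : ℕ∞ :=
  ⨅ (n : ℕ) (_ : 1 ≤ n) (_ : optErrorProb p ρ q σ n ≤ ε), (n : ℕ∞)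

/-- The trivial cases, in which the sample complexity is `1` or `∞`. -/
def IsTrivialCase (p : ℝ) (ρ : H →L[ℂ] H) (q : ℝ) (σ : H →L[ℂ] H) (ε : ℝ) : Prop :=
  ρ * σ = 0 ∨ ε ∈ Set.Icc (1 / 2) 1 ∨ (∃ s ∈ Set.Icc (0 : ℝ) 1, p ^ s * q ^ (1 - s) ≤ ε) ∨
    (ρ = σ ∧ ε < min p q ∧ ε ∈ Set.Ico 0 (1 / 2))

/-- `ln (x / ε)` for `x > 0` and `ε ≥ 0`, with the value `+∞` for `ε = 0`. -/
def logDiv (x ε : ℝ) : EReal :=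
  ENNReal.log (ENNReal.ofReal x / ENNReal.ofReal ε)

/-- The quantity `ln (p^s q^{1-s} / ε) / (- ln Tr[ρ^s σ^{1-s}])`, in `[0, ∞]`. Outside the trivial
cases, the numerator is positive (and `+∞` if `ε = 0`), and the denominator is nonnegative;
the quotient is `+∞` where the denominator vanishes. -/
def chernoffRatio (p : ℝ) (ρ : H →L[ℂ] H) (q : ℝ) (σ : H →L[ℂ] H) (ε s : ℝ) : ℝ≥0∞ :=
  (logDiv (p ^ s * q ^ (1 - s)) ε).toENNReal /
    ENNReal.ofReal (-Real.log (trace (ρ ^ s * σ ^ (1 - s))).re)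

end Testing

end QHT

end

/-! Both bounds reduce to estimates for Hilbert-Schmidt operators. With `hsSq A` = Tr[A†A], a
positive trace-class T is treated through `hsSq (CFC.sqrt T)`, and Tr[PQ] for positive P, Q through
the manifestly nonnegative `hsSq (CFC.sqrt P * CFC.sqrt Q)`. Traces of products of two
Hilbert-Schmidt operators are values of `hsInner`, which makes Cauchy-Schwarz and cyclicity
available in infinite dimension.

Lower bounds. A contraction W with ⟨√ρ W, √σ⟩ = ‖√ρ√σ‖₁ comes from a polar decomposition. Inserting
I = Λ + (I - Λ) and applying Cauchy-Schwarz twice gives p q F ≤ e(1 - e) for the error e of any test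
(`mul_norm_hsInner_sq_le`). Using W^{⊗n} on n copies replaces F by Fⁿ, so p_e(n) ≤ ε < 1/2 forces p
q Fⁿ ≤ ε(1 - ε). Bounding the right side by ε and taking logarithms gives the first term. For the
second, 1 - d_B²/2 ≤ √F (`one_sub_buresDist_sq_le`) and Bernoulli's inequality give Fⁿ ≥ 1 - n d_B².

Upper bound. The test projecting onto the range of D₊, D = pρ - qσ, has error p - Tr D₊. The trace
inequality `hsSq_sqrt_le_posPart_add`, a consequence of operator monotonicity of fractional powers,
bounds it by p^s q^(1-s) Tr[ρ^s σ^(1-s)]. The last trace is multiplicative under tensor powers, so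
any n above the Chernoff ratio at some s suffices. The infimum over s is reached by a limit, using
Tr[ρσ] > 0 as a lower bound for Tr[ρ^s σ^(1-s)] uniform in s. -/

noncomputable section

namespace QHT

universe u v

/-! ### Hilbert-Schmidt norm and inner product, and cyclicity of the trace. -/

section HilbertSchmidt

variable {H : Type*} [NormedAddCommGroup H] [InnerProductSpace ℂ H] [CompleteSpace H]
variable {ι κ : Type*}

/-- The square of the Hilbert-Schmidt norm, in `[0, ∞]`. -/
def hsSq (A : H →L[ℂ] H) : ℝ≥0∞ :=
  ∑' i, ‖A (basis H i)‖ₑ ^ 2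

theorem enorm_sq_eq_ofReal {E : Type*} [NormedAddCommGroup E] (x : E) : ‖x‖ₑ ^ 2 = ENNReal.ofReal (‖x‖ ^ 2) := by
  rw [← ofReal_norm, ENNReal.ofReal_pow (norm_nonneg x)]

theorem tsum_enorm_inner_sq {E : Type*} [NormedAddCommGroup E] [InnerProductSpace ℂ E]
    (b : HilbertBasis ι ℂ E) (x : E) :
    ∑' i, ‖⟪b i, x⟫_ℂ‖ₑ ^ 2 = ‖x‖ₑ ^ 2 := by
  have h := b.hasSum_inner_mul_inner x x
  have h' : HasSum (fun i => ‖⟪b i, x⟫_ℂ‖ ^ 2) (‖x‖ ^ 2) := by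
    have := (Complex.hasSum_iff _ _).1 h
    convert this.1 using 1
    · ext i
      rw [← inner_conj_symm x (b i), ← Complex.normSq_eq_conj_mul_self, Complex.normSq_eq_norm_sq,
        Complex.ofReal_re]
    · rw [← inner_self_eq_norm_sq (𝕜 := ℂ)]
      rfl
  rw [enorm_sq_eq_ofReal, ← h'.tsum_eq,
    ENNReal.ofReal_tsum_of_nonneg (fun _ => by positivity) h'.summable]
  refine tsum_congr fun i => ?_
  rw [← ofReal_norm, ENNReal.ofReal_pow (norm_nonneg _)]

/-- Parseval in `c`, exchange of the two nonnegative sums, Parseval in `b`. As the bases are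
arbitrary, this yields both basis independence and invariance under the adjoint. -/
theorem tsum_enorm_sq_star (b : HilbertBasis ι ℂ H) (c : HilbertBasis κ ℂ H) (A : H →L[ℂ] H) :
    ∑' i, ‖A (b i)‖ₑ ^ 2 = ∑' j, ‖star A (c j)‖ₑ ^ 2 := by
  rw [tsum_congr fun i => (tsum_enorm_inner_sq c (A (b i))).symm,
    tsum_congr fun j => (tsum_enorm_inner_sq b (star A (c j))).symm, ENNReal.tsum_comm]
  refine tsum_congr fun j => tsum_congr fun i => ?_
  rw [ContinuousLinearMap.star_eq_adjoint, ContinuousLinearMap.adjoint_inner_right,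
    ← inner_conj_symm, ← ofReal_norm, ← ofReal_norm, Complex.norm_conj]

theorem hsSq_eq (b : HilbertBasis ι ℂ H) (A : H →L[ℂ] H) :
    hsSq A = ∑' i, ‖A (b i)‖ₑ ^ 2 := by
  rw [hsSq, tsum_enorm_sq_star (basis H) b A, tsum_enorm_sq_star b b A]

theorem hsSq_star (A : H →L[ℂ] H) : hsSq (star A) = hsSq A := by
  rw [hsSq, hsSq, tsum_enorm_sq_star (basis H) (basis H) A]

theorem inner_star_mul_self (A : H →L[ℂ] H) (x : H) :
    ⟪x, (star A * A) x⟫_ℂ = ((‖A x‖ ^ 2 : ℝ) : ℂ) := by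
  rw [ContinuousLinearMap.star_eq_adjoint, mul_apply_eq_comp,
    ContinuousLinearMap.adjoint_inner_right, inner_self_eq_norm_sq_to_K]
  simp

theorem posTrace_star_mul_self (A : H →L[ℂ] H) : posTrace (star A * A) = hsSq A := by
  refine tsum_congr fun i => ?_
  rw [inner_star_mul_self, enorm_sq_eq_ofReal, Complex.ofReal_re]

theorem hsSq_mul_le_left (A B : H →L[ℂ] H) : hsSq (A * B) ≤ ‖A‖ₑ ^ 2 * hsSq B := by
  rw [hsSq, hsSq, ← ENNReal.tsum_mul_left]
  refine ENNReal.tsum_le_tsum fun i => ?_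
  rw [← mul_pow]
  gcongr
  exact A.le_opENorm _

theorem hsSq_mul_le_right (A B : H →L[ℂ] H) : hsSq (A * B) ≤ hsSq A * ‖B‖ₑ ^ 2 := by
  rw [← hsSq_star (A * B), star_mul, ← hsSq_star A, mul_comm (hsSq _)]
  refine (hsSq_mul_le_left _ _).trans_eq ?_
  congr 2
  rw [← ofReal_norm, ← ofReal_norm, norm_star]

theorem hsSq_mul_ne_top_left (A : H →L[ℂ] H) {B : H →L[ℂ] H} (hB : hsSq B ≠ ⊤) :
    hsSq (A * B) ≠ ⊤ :=
  ne_top_of_le_ne_top (ENNReal.mul_ne_top (by simp) hB) (hsSq_mul_le_left A B)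

theorem hsSq_mul_ne_top_right {A : H →L[ℂ] H} (hA : hsSq A ≠ ⊤) (B : H →L[ℂ] H) :
    hsSq (A * B) ≠ ⊤ :=
  ne_top_of_le_ne_top (ENNReal.mul_ne_top hA (by simp)) (hsSq_mul_le_right A B)

theorem hsSq_mul_le_of_norm_le_one_left {A : H →L[ℂ] H} (hA : ‖A‖ ≤ 1) (B : H →L[ℂ] H) :
    hsSq (A * B) ≤ hsSq B := by
  refine (hsSq_mul_le_left A B).trans ?_
  have : ‖A‖ₑ ≤ 1 := by
    rw [← ofReal_norm]
    exact ENNReal.ofReal_le_one.2 hA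
  exact (mul_le_mul_left (pow_le_one' this 2) _).trans_eq (one_mul _)

theorem hsSq_mul_le_of_norm_le_one_right (A : H →L[ℂ] H) {B : H →L[ℂ] H} (hB : ‖B‖ ≤ 1) :
    hsSq (A * B) ≤ hsSq A := by
  rw [← hsSq_star (A * B), star_mul, ← hsSq_star A]
  exact hsSq_mul_le_of_norm_le_one_left (by rwa [norm_star]) _

/-- The map `A ↦ (A (b i))ᵢ` embeds Hilbert-Schmidt operators isometrically into ℓ²(ι; H), from
which the norm and inner product facts below are transported. -/
theorem memℓp_of_hsSq_ne_top (b : HilbertBasis ι ℂ H) {A : H →L[ℂ] H} (hA : hsSq A ≠ ⊤) :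
    Memℓp (fun i => A (b i)) 2 := by
  refine memℓp_gen ?_
  rw [hsSq_eq b] at hA
  have := ENNReal.summable_toReal hA
  simpa [ENNReal.toReal_pow] using this

theorem toReal_hsSq (b : HilbertBasis ι ℂ H) {A : H →L[ℂ] H} (hA : hsSq A ≠ ⊤) :
    (hsSq A).toReal = ‖(⟨_, memℓp_of_hsSq_ne_top b hA⟩ : lp (fun _ : ι => H) 2)‖ ^ 2 := by
  have := lp.norm_rpow_eq_tsum (p := 2) (by simp)
    (⟨_, memℓp_of_hsSq_ne_top b hA⟩ : lp (fun _ : ι => H) 2)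
  simp only [ENNReal.toReal_ofNat, Real.rpow_ofNat] at this
  rw [this, hsSq_eq b, ENNReal.tsum_toReal_eq (fun i => by simp)]
  simp

theorem hsSq_add_ne_top {A B : H →L[ℂ] H} (hA : hsSq A ≠ ⊤) (hB : hsSq B ≠ ⊤) :
    hsSq (A + B) ≠ ⊤ := by
  have h := (memℓp_of_hsSq_ne_top (basis H) hA).add (memℓp_of_hsSq_ne_top (basis H) hB)
  have h' := (memℓp_gen_iff (by simp)).1 h
  simp only [ENNReal.toReal_ofNat, Real.rpow_ofNat] at h'
  rw [hsSq]
  convert h'.tsum_ofReal_ne_top using 3 with i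
  rw [enorm_sq_eq_ofReal]
  rfl

theorem hsSq_smul (c : ℂ) (A : H →L[ℂ] H) : hsSq (c • A) = ‖c‖ₑ ^ 2 * hsSq A := by
  simp [hsSq, ← ENNReal.tsum_mul_left, enorm_smul, mul_pow]

theorem hsSq_smul_ne_top (c : ℂ) {A : H →L[ℂ] H} (hA : hsSq A ≠ ⊤) : hsSq (c • A) ≠ ⊤ := by
  rw [hsSq_smul]
  exact ENNReal.mul_ne_top (by simp) hA

theorem hsSq_neg (A : H →L[ℂ] H) : hsSq (-A) = hsSq A := by
  simp [hsSq]

theorem hsSq_sub_ne_top {A B : H →L[ℂ] H} (hA : hsSq A ≠ ⊤) (hB : hsSq B ≠ ⊤) :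
    hsSq (A - B) ≠ ⊤ := by
  rw [sub_eq_add_neg]
  exact hsSq_add_ne_top hA (by rwa [hsSq_neg])

/-- The Hilbert-Schmidt inner product, by polarization. -/
def hsInner (A B : H →L[ℂ] H) : ℂ :=
  (((hsSq (A + B)).toReal : ℂ) - (hsSq (A - B)).toReal +
    ((hsSq (A - Complex.I • B)).toReal - (hsSq (A + Complex.I • B)).toReal) * Complex.I) / 4

theorem hsInner_eq_inner_lp (b : HilbertBasis ι ℂ H) {A B : H →L[ℂ] H} (hA : hsSq A ≠ ⊤)
    (hB : hsSq B ≠ ⊤) :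
    hsInner A B = ⟪(⟨_, memℓp_of_hsSq_ne_top b hA⟩ : lp (fun _ : ι => H) 2),
      (⟨_, memℓp_of_hsSq_ne_top b hB⟩ : lp (fun _ : ι => H) 2)⟫_ℂ := by
  have hI := hsSq_smul_ne_top Complex.I hB
  rw [inner_eq_sum_norm_sq_div_four, hsInner, toReal_hsSq b (hsSq_add_ne_top hA hB),
    toReal_hsSq b (hsSq_sub_ne_top hA hB), toReal_hsSq b (hsSq_sub_ne_top hA hI),
    toReal_hsSq b (hsSq_add_ne_top hA hI)]
  push_cast
  rfl

/-- Polarization expresses `hsInner` through `hsSq`, which is basis independent; hence the series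
has the same sum in every Hilbert basis. -/
theorem hasSum_hsInner (b : HilbertBasis ι ℂ H) {A B : H →L[ℂ] H} (hA : hsSq A ≠ ⊤)
    (hB : hsSq B ≠ ⊤) : HasSum (fun i => ⟪A (b i), B (b i)⟫_ℂ) (hsInner A B) := by
  rw [hsInner_eq_inner_lp b hA hB]
  exact lp.hasSum_inner _ _

theorem norm_hsInner_le {A B : H →L[ℂ] H} (hA : hsSq A ≠ ⊤) (hB : hsSq B ≠ ⊤) :
    ‖hsInner A B‖ ≤ √(hsSq A).toReal * √(hsSq B).toReal := by
  rw [hsInner_eq_inner_lp (basis H) hA hB, toReal_hsSq (basis H) hA, toReal_hsSq (basis H) hB,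
    Real.sqrt_sq (norm_nonneg _), Real.sqrt_sq (norm_nonneg _)]
  exact norm_inner_le_norm _ _

/-- This is cyclicity, Tr[B A†] = Tr[A† B]: the adjoint preserves `hsSq`, so the polarization terms
match up. -/
theorem hsInner_star_star (A B : H →L[ℂ] H) : hsInner (star B) (star A) = hsInner A B := by
  have h₁ : hsSq (star B + star A) = hsSq (A + B) := by rw [← star_add, hsSq_star, add_comm]
  have h₂ : hsSq (star B - star A) = hsSq (A - B) := by
    rw [← star_sub, hsSq_star, ← hsSq_neg, neg_sub]
  have h₃ : hsSq (star B - Complex.I • star A) = hsSq (A - Complex.I • B) := by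
    have : star B - Complex.I • star A = star (Complex.I • (A - Complex.I • B)) := by
      simp [smul_sub, smul_smul]
      abel
    rw [this, hsSq_star, hsSq_smul, ← ofReal_norm, Complex.norm_I, ENNReal.ofReal_one, one_pow,
      one_mul]
  have h₄ : hsSq (star B + Complex.I • star A) = hsSq (A + Complex.I • B) := by
    have : star B + Complex.I • star A = star (-(Complex.I • (A + Complex.I • B))) := by
      simp [smul_add, smul_smul, star_add]
    rw [this, hsSq_star, hsSq_neg, hsSq_smul, ← ofReal_norm, Complex.norm_I, ENNReal.ofReal_one,
      one_pow, one_mul]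
  rw [hsInner, hsInner, h₁, h₂, h₃, h₄]

theorem hsInner_self {A : H →L[ℂ] H} (hA : hsSq A ≠ ⊤) : hsInner A A = (hsSq A).toReal := by
  rw [hsInner_eq_inner_lp (basis H) hA hA, toReal_hsSq (basis H) hA, inner_self_eq_norm_sq_to_K]
  simp

theorem hasSum_inner_star_mul (b : HilbertBasis ι ℂ H) {A B : H →L[ℂ] H} (hA : hsSq A ≠ ⊤)
    (hB : hsSq B ≠ ⊤) : HasSum (fun i => ⟪b i, (star A * B) (b i)⟫_ℂ) (hsInner A B) := by
  convert hasSum_hsInner b hA hB using 2 with i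
  rw [ContinuousLinearMap.star_eq_adjoint, mul_apply_eq_comp,
    ContinuousLinearMap.adjoint_inner_right]

theorem trace_star_mul {A B : H →L[ℂ] H} (hA : hsSq A ≠ ⊤) (hB : hsSq B ≠ ⊤) :
    trace (star A * B) = hsInner A B :=
  (hasSum_inner_star_mul (basis H) hA hB).tsum_eq

theorem hsInner_mul_left (A B C : H →L[ℂ] H) (hA : hsSq A ≠ ⊤) (hB : hsSq B ≠ ⊤) :
    hsInner (C * A) B = hsInner A (star C * B) := by
  rw [← trace_star_mul (hsSq_mul_ne_top_left C hA) hB,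
    ← trace_star_mul hA (hsSq_mul_ne_top_left _ hB), star_mul, mul_assoc]

theorem hsInner_mul_right (A B C : H →L[ℂ] H) (hA : hsSq A ≠ ⊤) (hB : hsSq B ≠ ⊤) :
    hsInner (A * C) B = hsInner A (B * star C) := by
  rw [← hsInner_star_star, ← hsInner_star_star A, star_mul, star_mul, star_star]
  exact (hsInner_mul_left _ _ _ (by rwa [hsSq_star]) (by rwa [hsSq_star])).symm

end HilbertSchmidt

/-! ### Compactness, eigenbases, and fractional powers on eigenvectors. -/

section Eigenbasis

variable {H : Type u} [NormedAddCommGroup H] [InnerProductSpace ℂ H] [CompleteSpace H]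
variable {ι : Type*}

theorem enorm_sq_le_hsSq (A : H →L[ℂ] H) : ‖A‖ₑ ^ 2 ≤ hsSq A := by
  by_cases hA : hsSq A = ⊤
  · simp [hA]
  rw [enorm_sq_eq_ofReal]
  refine ENNReal.ofReal_le_of_le_toReal ?_
  rw [← Real.le_sqrt (norm_nonneg _) ENNReal.toReal_nonneg]
  refine A.opNorm_le_bound (Real.sqrt_nonneg _) fun x => ?_
  refine (abs_le_of_sq_le_sq' ?_ (by positivity)).2
  rw [mul_pow, Real.sq_sqrt ENNReal.toReal_nonneg]
  have h : ‖A x‖ₑ ^ 2 ≤ hsSq A * ‖x‖ₑ ^ 2 := by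
    rw [← tsum_enorm_inner_sq (basis H), ← hsSq_star, hsSq, ← ENNReal.tsum_mul_right]
    refine ENNReal.tsum_le_tsum fun i => ?_
    rw [← ContinuousLinearMap.adjoint_inner_left, ← mul_pow, ← ContinuousLinearMap.star_eq_adjoint]
    gcongr
    simp only [← ofReal_norm]
    rw [← ENNReal.ofReal_mul (norm_nonneg _)]
    exact ENNReal.ofReal_le_ofReal (norm_inner_le_norm _ _)
  have h' := ENNReal.toReal_mono (ENNReal.mul_ne_top hA (by simp)) h
  simpa [ENNReal.toReal_mul] using h'

/-- The finite-rank truncations in a Hilbert basis converge in Hilbert-Schmidt norm, because tails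
of a convergent series vanish, and therefore in operator norm. -/
theorem isCompactOperator_of_hsSq_ne_top {A : H →L[ℂ] H} (hA : hsSq A ≠ ⊤) :
    IsCompactOperator A := by
  classical
  let b := basis H
  let T : Finset (basisIndex H) → H →L[ℂ] H :=
    fun F => ∑ i ∈ F, (innerSL ℂ (b i)).smulRight (A (b i))
  have hT (F : Finset (basisIndex H)) : T F ∈ compactOperator (RingHom.id ℂ) H H := by
    refine Submodule.sum_mem _ fun i _ => ?_
    have h : IsCompactOperator (id : ℂ → ℂ) :=
      (isCompactOperator_id_iff_finiteDimensional (𝕜 := ℂ)).2 inferInstance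
    exact (h.comp_clm (innerSL ℂ (b i))).clm_comp
      ((1 : ℂ →L[ℂ] ℂ).smulRight (A (b i)))
  have happ (F : Finset (basisIndex H)) (j : basisIndex H) :
      (A - T F) (b j) = if j ∈ F then 0 else A (b j) := by
    have : T F (b j) = if j ∈ F then A (b j) else 0 := by
      simp [T, orthonormal_iff_ite.1 b.orthonormal]
    rw [sub_apply, this]
    split_ifs <;> simp
  have hsum (F : Finset (basisIndex H)) :
      hsSq (A - T F) = ∑' i : {i // i ∉ F}, ‖A (b i)‖ₑ ^ 2 := by
    refine Eq.trans ?_ (tsum_subtype {i | i ∉ F} fun i => ‖A (b i)‖ₑ ^ 2).symm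
    refine tsum_congr fun j => ?_
    rw [show basis H = b from rfl, happ]
    by_cases h : j ∈ F <;> simp [h, Set.indicator]
  have hlim : Filter.Tendsto (fun F => hsSq (A - T F)) Filter.atTop (nhds 0) := by
    simp_rw [hsum]
    exact ENNReal.tendsto_tsum_compl_atTop_zero hA
  refine isCompactOperator_of_tendsto (l := Filter.atTop) (F := T) ?_ (.of_forall hT)
  rw [tendsto_iff_norm_sub_tendsto_zero]
  have h2 : Filter.Tendsto (fun F => ‖T F - A‖ ^ 2) Filter.atTop (nhds 0) := by
    have := (ENNReal.tendsto_toReal ENNReal.zero_ne_top).comp hlim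
    refine squeeze_zero' (.of_forall fun _ => by positivity) ?_ this
    filter_upwards [hlim.eventually_lt_const (ENNReal.zero_lt_top)] with F hF
    have := ENNReal.toReal_mono hF.ne (enorm_sq_le_hsSq (A - T F))
    rw [norm_sub_rev]
    simpa using this
  simpa using h2.sqrt

theorem posTrace_eq_hsSq_sqrt {A : H →L[ℂ] H} (hA : 0 ≤ A) : posTrace A = hsSq (CFC.sqrt A) := by
  rw [← posTrace_star_mul_self, (CFC.sqrt_nonneg A).isSelfAdjoint.star_eq,
    CFC.sqrt_mul_sqrt_self A]

/-- A positive operator of finite trace has an orthonormal eigenbasis. -/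
theorem exists_eigenbasis {A : H →L[ℂ] H} (hA : 0 ≤ A) (h : hsSq (CFC.sqrt A) ≠ ⊤) :
    ∃ (ι : Type u) (b : HilbertBasis ι ℂ H) (μ : ι → ℝ≥0), ∀ i, A (b i) = ((μ i : ℝ) : ℂ) • b i := by
  have hc : IsCompactOperator A := by
    rw [← CFC.sqrt_mul_sqrt_self A]
    exact (isCompactOperator_of_hsSq_ne_top h).clm_comp (CFC.sqrt A)
  have hs : A.IsSymmetric := hA.isSelfAdjoint.isSymmetric
  have hbot := ContinuousLinearMap.orthogonalComplement_iSup_eigenspaces_eq_bot hc hs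
  have hfam := LinearMap.IsSymmetric.orthogonalFamily_eigenspaces hs
  let E : ℂ → Submodule ℂ H := fun μ => Module.End.eigenspace (A : Module.End ℂ H) μ
  have hcl (μ : ℂ) : IsClosed (E μ : Set H) := by
    have : (E μ : Set H) = {x | A x = μ • x} := by
      ext x
      simp [E]
    rw [this]
    exact isClosed_eq (by fun_prop) (by fun_prop)
  have (μ : ℂ) : CompleteSpace (E μ) := (hcl μ).completeSpace_coe
  -- A Hilbert basis is chosen in every eigenspace, over all complex `μ`; non-eigenvalues contribute
  -- empty families.
  choose w c hw using fun μ => exists_hilbertBasis ℂ (E μ)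
  have ho := hfam.orthonormal_sigma_orthonormal (fun μ => (c μ).orthonormal)
  let b := HilbertBasis.mkOfOrthogonalEqBot ho (by
    rw [Submodule.eq_bot_iff]
    intro x hx
    rw [Submodule.mem_orthogonal] at hx
    have : x ∈ (⨆ μ, E μ)ᗮ := by
      rw [← Submodule.iInf_orthogonal, Submodule.mem_iInf]
      intro μ
      rw [Submodule.mem_orthogonal]
      intro y hy
      have h0 : (innerSL ℂ x ∘L (E μ).subtypeL) = 0 := by
        refine ContinuousLinearMap.ext_on
          (Submodule.dense_iff_topologicalClosure_eq_top.2 (c μ).dense_span) ?_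
        rintro _ ⟨i, rfl⟩
        have := hx _ (Submodule.subset_span ⟨⟨μ, i⟩, rfl⟩)
        exact inner_eq_zero_symm.1 this
      exact inner_eq_zero_symm.1 (congrArg (fun f => f ⟨y, hy⟩) h0)
    rw [hbot] at this
    exact (Submodule.mem_bot ℂ).1 this)
  -- The eigenvalue equals ⟨bᵢ, A bᵢ⟩ = ‖√A bᵢ‖², which exhibits it as a nonnegative real.
  refine ⟨_, b, fun i => ‖CFC.sqrt A (b i)‖₊ ^ 2, fun i => ?_⟩
  have hb : b i = (c i.1 i.2 : H) := by
    simp [b, HilbertBasis.coe_mkOfOrthogonalEqBot]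
  have hE : A (b i) = i.1 • b i := by
    rw [hb]
    exact Module.End.mem_eigenspace_iff.1 (c i.1 i.2).2
  have hin := inner_star_mul_self (CFC.sqrt A) (b i)
  rw [(CFC.sqrt_nonneg A).isSelfAdjoint.star_eq, CFC.sqrt_mul_sqrt_self A, hE, inner_smul_right,
    inner_self_eq_norm_sq_to_K, b.orthonormal.1 i] at hin
  rw [hE]
  congr 1
  simpa using hin

/-- The functional calculus acts on eigenvectors through the eigenvalue. -/
theorem cfcHom_apply_eigenvector {A : H →L[ℂ] H} (hA : IsSelfAdjoint A) {x : H} {μ : ℝ}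
    (hμ : μ ∈ spectrum ℝ A) (hx : A x = (μ : ℂ) • x) (f : C(spectrum ℝ A, ℝ)) :
    cfcHom hA f x = ((f ⟨μ, hμ⟩ : ℝ) : ℂ) • x := by
  have hc : Continuous fun f : C(spectrum ℝ A, ℝ) => cfcHom hA f x :=
    (ContinuousLinearMap.apply ℂ H x).continuous.comp (cfcHom_continuous hA)
  have hc' : Continuous fun f : C(spectrum ℝ A, ℝ) => ((f ⟨μ, hμ⟩ : ℝ) : ℂ) • x := by fun_prop
  have hid : cfcHom hA (.restrict (spectrum ℝ A) (.id ℝ)) = A := cfcHom_id hA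
  -- Both sides are continuous in `f`, so by Stone-Weierstrass polynomials suffice.
  induction f using ContinuousMap.induction_on_of_compact with
  | const r =>
    have : (ContinuousMap.const (spectrum ℝ A) r) = algebraMap ℝ _ r := rfl
    rw [this, AlgHomClass.commutes, Algebra.algebraMap_eq_smul_one]
    simp
  | id => simpa [hid] using hx
  | star_id => simpa [hid] using hx
  | add f g hf hg => simp [hf, hg, add_smul]
  | mul f g hf hg => 
    rw [map_mul, mul_apply_eq_comp, hg, map_smul, hf, smul_smul, ContinuousMap.mul_apply,
      Complex.ofReal_mul, mul_comm]
  | frequently f h => exact h.mem_of_closed (isClosed_eq hc hc')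

theorem rpow_apply_eigenvector {A : H →L[ℂ] H} (hA : 0 ≤ A) {x : H} {μ : ℝ≥0}
    (hx : A x = ((μ : ℝ) : ℂ) • x) {s : ℝ} (hs : 0 ≤ s) :
    (A ^ s) x = (((μ : ℝ) ^ s : ℝ) : ℂ) • x := by
  by_cases h0 : x = 0
  · simp [h0]
  have hμ : (μ : ℝ) ∈ spectrum ℝ A := by
    rw [spectrum.mem_iff]
    intro hu
    obtain ⟨B, hB⟩ := hu.exists_left_inv
    have := congrArg (fun T => T x) hB
    simp [hx, Algebra.algebraMap_eq_smul_one] at this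
    exact h0 this.symm
  have hcont : ContinuousOn (fun t : ℝ => t ^ s) (spectrum ℝ A) :=
    (Real.continuous_rpow_const hs).continuousOn
  rw [CFC.rpow_eq_cfc_real, cfc_apply _ A hA.isSelfAdjoint hcont,
    cfcHom_apply_eigenvector hA.isSelfAdjoint hμ hx]
  rfl

end Eigenbasis

/-! ### Trace inequalities for fractional powers. -/

section Weighted

variable {H : Type u} [NormedAddCommGroup H] [InnerProductSpace ℂ H] [CompleteSpace H]

theorem rpow_add_of_nonneg (A : H →L[ℂ] H) {a b : ℝ} (ha : 0 ≤ a) (hb : 0 ≤ b) :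
    A ^ (a + b) = A ^ a * A ^ b := by
  simp only [CFC.rpow_def]
  rw [← cfc_mul _ _ A (NNReal.continuous_rpow_const ha).continuousOn
    (NNReal.continuous_rpow_const hb).continuousOn]
  exact cfc_congr fun x _ => NNReal.rpow_add_of_nonneg x ha hb

theorem sqrt_rpow_of_nonneg (A : H →L[ℂ] H) {a : ℝ} (ha : 0 ≤ a) :
    CFC.sqrt (A ^ a) = A ^ (a / 2) :=
  CFC.sqrt_rpow_nnreal (x := ⟨a, ha⟩)

theorem star_rpow (A : H →L[ℂ] H) (a : ℝ) : star (A ^ a) = A ^ a :=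
  CFC.rpow_nonneg.isSelfAdjoint.star_eq

theorem star_sqrt (A : H →L[ℂ] H) : star (CFC.sqrt A) = CFC.sqrt A :=
  (CFC.sqrt_nonneg A).isSelfAdjoint.star_eq

/-- `Tr[X† P X]` is additive in `P ≥ 0`. -/
theorem hsSq_sqrt_add_mul {P Q : H →L[ℂ] H} (hP : 0 ≤ P) (hQ : 0 ≤ Q) (X : H →L[ℂ] H) :
    hsSq (CFC.sqrt (P + Q) * X) = hsSq (CFC.sqrt P * X) + hsSq (CFC.sqrt Q * X) := by
  have key {R : H →L[ℂ] H} (hR : 0 ≤ R) (x : H) :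
      ‖CFC.sqrt R x‖ ^ 2 = (⟪x, R x⟫_ℂ).re := by
    have := inner_star_mul_self (CFC.sqrt R) x
    rw [star_sqrt, CFC.sqrt_mul_sqrt_self R] at this
    rw [this, Complex.ofReal_re]
  rw [hsSq, hsSq, hsSq, ← ENNReal.tsum_add]
  refine tsum_congr fun i => ?_
  simp only [mul_apply_eq_comp, enorm_sq_eq_ofReal]
  rw [← ENNReal.ofReal_add (by positivity) (by positivity), key (add_nonneg hP hQ), key hP, key hQ,
    add_apply, inner_add_right, Complex.add_re]

theorem hsSq_sqrt_mul_sqrt_comm (P Q : H →L[ℂ] H) :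
    hsSq (CFC.sqrt P * CFC.sqrt Q) = hsSq (CFC.sqrt Q * CFC.sqrt P) := by
  rw [← hsSq_star, star_mul, star_sqrt, star_sqrt]

theorem hsSq_mul_sqrt_add {P Q : H →L[ℂ] H} (hP : 0 ≤ P) (hQ : 0 ≤ Q) (R : H →L[ℂ] H) :
    hsSq (CFC.sqrt R * CFC.sqrt (P + Q)) =
      hsSq (CFC.sqrt R * CFC.sqrt P) + hsSq (CFC.sqrt R * CFC.sqrt Q) := by
  simp only [hsSq_sqrt_mul_sqrt_comm R, hsSq_sqrt_add_mul hP hQ]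

theorem hsSq_sqrt_add {P Q : H →L[ℂ] H} (hP : 0 ≤ P) (hQ : 0 ≤ Q) :
    hsSq (CFC.sqrt (P + Q)) = hsSq (CFC.sqrt P) + hsSq (CFC.sqrt Q) := by
  simpa using hsSq_sqrt_add_mul hP hQ 1

theorem hsSq_sqrt_mul_mono {P Q : H →L[ℂ] H} (hP : 0 ≤ P) (h : P ≤ Q) (X : H →L[ℂ] H) :
    hsSq (CFC.sqrt P * X) ≤ hsSq (CFC.sqrt Q * X) := by
  have := hsSq_sqrt_add_mul hP (sub_nonneg.2 h) X
  rw [add_sub_cancel] at this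
  rw [this]
  exact le_self_add

theorem hsSq_mul_sqrt_mono {P Q : H →L[ℂ] H} (hP : 0 ≤ P) (h : P ≤ Q) (R : H →L[ℂ] H) :
    hsSq (CFC.sqrt R * CFC.sqrt P) ≤ hsSq (CFC.sqrt R * CFC.sqrt Q) := by
  simpa only [hsSq_sqrt_mul_sqrt_comm R] using hsSq_sqrt_mul_mono hP h _

theorem sqrt_rpow_mul_sqrt_rpow (A : H →L[ℂ] H) {s : ℝ} (hs : s ∈ Set.Icc (0 : ℝ) 1) :
    CFC.sqrt (A ^ s) * CFC.sqrt (A ^ (1 - s)) = CFC.sqrt A := by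
  have h1 : 0 ≤ 1 - s := sub_nonneg.2 hs.2
  rw [sqrt_rpow_of_nonneg A hs.1, sqrt_rpow_of_nonneg A h1,
    ← rpow_add_of_nonneg A (by linarith [hs.1]) (by linarith), CFC.sqrt_eq_rpow]
  congr 1
  ring

/-- The trace inequality behind the quantum Chernoff bound:
`Tr A ≤ Tr (A - B)₊ + Tr B^s A^(1-s)`. -/
theorem hsSq_sqrt_le_posPart_add {A B : H →L[ℂ] H} (hA : 0 ≤ A) (hB : 0 ≤ B)
    (hB' : hsSq (CFC.sqrt B) ≠ ⊤) {s : ℝ} (hs : s ∈ Set.Icc (0 : ℝ) 1) :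
    hsSq (CFC.sqrt A) ≤ hsSq (CFC.sqrt (A - B)⁺) +
      hsSq (CFC.sqrt (B ^ s) * CFC.sqrt (A ^ (1 - s))) := by
  have hs' : 1 - s ∈ Set.Icc (0 : ℝ) 1 := ⟨sub_nonneg.2 hs.2, by linarith [hs.1]⟩
  -- `C` dominates both operators, since A = B + (A - B)₊ - (A - B)₋, and so do its powers with
  -- exponents in [0, 1].
  set C := B + (A - B)⁺ with hC
  have hpos : 0 ≤ (A - B)⁺ := CFC.posPart_nonneg _
  have hBC : B ≤ C := le_add_of_nonneg_right hpos
  have hAC : A ≤ C := by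
    have h1 : (A - B)⁺ - (A - B)⁻ = A - B :=
      CFC.posPart_sub_negPart (A - B) (hA.isSelfAdjoint.sub hB.isSelfAdjoint)
    have h2 : 0 ≤ (A - B)⁻ := CFC.negPart_nonneg _
    have h3 : A = B + ((A - B)⁺ - (A - B)⁻) := by rw [h1]; abel
    rw [h3, hC]
    gcongr
    exact sub_le_self _ h2
  have hC0 : 0 ≤ C := hB.trans hBC
  have h₁ : A ^ s ≤ C ^ s := CFC.rpow_le_rpow hs hAC
  have h₂ : B ^ s ≤ C ^ s := CFC.rpow_le_rpow hs hBC
  have h₃ : A ^ (1 - s) ≤ C ^ (1 - s) := CFC.rpow_le_rpow hs' hAC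
  have h₄ : B ^ (1 - s) ≤ C ^ (1 - s) := CFC.rpow_le_rpow hs' hBC
  have key : hsSq (CFC.sqrt A) + hsSq (CFC.sqrt B) ≤
      hsSq (CFC.sqrt C) + hsSq (CFC.sqrt (B ^ s) * CFC.sqrt (A ^ (1 - s))) := by
    rw [← sqrt_rpow_mul_sqrt_rpow A hs, ← sqrt_rpow_mul_sqrt_rpow B hs,
      ← sqrt_rpow_mul_sqrt_rpow C hs]
    have hA1 := CFC.rpow_nonneg (a := A) (y := s)
    have hA2 := CFC.rpow_nonneg (a := A) (y := 1 - s)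
    have hB1 := CFC.rpow_nonneg (a := B) (y := s)
    have hB2 := CFC.rpow_nonneg (a := B) (y := 1 - s)
    generalize A ^ s = A₁ at *
    generalize B ^ s = B₁ at *
    generalize C ^ s = C₁ at *
    generalize A ^ (1 - s) = A₂ at *
    generalize B ^ (1 - s) = B₂ at *
    generalize C ^ (1 - s) = C₂ at *
    -- After replacing A₁ by C₁ and B₂ by C₂, what remains is Tr[B₁(C₂ - A₂)] ≤ Tr[C₁(C₂ - A₂)]; it
    -- holds because C₂ - A₂ ≥ 0 and B₁ ≤ C₁.
    refine (add_le_add (hsSq_sqrt_mul_mono hA1 h₁ _) (hsSq_mul_sqrt_mono hB2 h₄ _)).trans ?_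
    rw [← add_sub_cancel A₂ C₂, hsSq_mul_sqrt_add hA2 (sub_nonneg.2 h₃),
      hsSq_mul_sqrt_add hA2 (sub_nonneg.2 h₃), add_assoc]
    gcongr 1
    rw [add_comm]
    gcongr 1
    exact hsSq_sqrt_mul_mono hB1 h₂ _
  -- Tr C = Tr B + Tr (A - B)₊, and the finite Tr B cancels.
  rw [hC, hsSq_sqrt_add hB hpos, add_comm, add_assoc] at key
  exact (ENNReal.add_le_add_iff_left hB').1 key

/-- A substitute for Hölder's inequality: by operator monotonicity both powers may be replaced by
those of A + B, and the result is at most Tr A + Tr B. -/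
theorem hsSq_rpow_mul_rpow_ne_top {A B : H →L[ℂ] H} (hA : 0 ≤ A) (hB : 0 ≤ B)
    (hA' : hsSq (CFC.sqrt A) ≠ ⊤) (hB' : hsSq (CFC.sqrt B) ≠ ⊤)
    {a b : ℝ} (ha : 0 ≤ a) (hb : 0 ≤ b) (hab : a + b = 1 / 2) : hsSq (A ^ a * B ^ b) ≠ ⊤ := by
  have hC : hsSq (CFC.sqrt (A + B)) ≠ ⊤ := by
    rw [hsSq_sqrt_add hA hB]
    exact ENNReal.add_ne_top.2 ⟨hA', hB'⟩
  have hs : 2 * a ∈ Set.Icc (0 : ℝ) 1 := ⟨by linarith, by linarith⟩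
  have hs' : 1 - 2 * a ∈ Set.Icc (0 : ℝ) 1 := ⟨by linarith, by linarith⟩
  have e1 : A ^ a = CFC.sqrt (A ^ (2 * a)) := by
    rw [sqrt_rpow_of_nonneg A hs.1]; congr 1; ring
  have e2 : B ^ b = CFC.sqrt (B ^ (1 - 2 * a)) := by
    rw [sqrt_rpow_of_nonneg B hs'.1]; congr 1; linarith
  rw [← sqrt_rpow_mul_sqrt_rpow (A + B) hs] at hC
  have hA1 := CFC.rpow_nonneg (a := A) (y := 2 * a)
  have hB1 := CFC.rpow_nonneg (a := B) (y := 1 - 2 * a)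
  have h₁ : A ^ (2 * a) ≤ (A + B) ^ (2 * a) :=
    CFC.rpow_le_rpow hs (le_add_of_nonneg_right hB)
  have h₂ : B ^ (1 - 2 * a) ≤ (A + B) ^ (1 - 2 * a) :=
    CFC.rpow_le_rpow hs' (le_add_of_nonneg_left hA)
  rw [e1, e2]
  exact ne_top_of_le_ne_top hC
    ((hsSq_sqrt_mul_mono hA1 h₁ _).trans (hsSq_mul_sqrt_mono hB1 h₂ _))

/-- One of the exponents s, 1 - s is at least 1/2. Splitting a square root off that factor leaves
exponents of sum 1/2, so both pieces are Hilbert-Schmidt. -/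
theorem exists_rpow_mul_rpow_eq_star_mul {A B : H →L[ℂ] H} (hA : 0 ≤ A) (hB : 0 ≤ B)
    (hA' : hsSq (CFC.sqrt A) ≠ ⊤) (hB' : hsSq (CFC.sqrt B) ≠ ⊤)
    {s : ℝ} (hs : s ∈ Set.Icc (0 : ℝ) 1) :
    ∃ X Y : H →L[ℂ] H, hsSq X ≠ ⊤ ∧ hsSq Y ≠ ⊤ ∧ A ^ s * B ^ (1 - s) = star X * Y := by
  have h1 : 0 ≤ 1 - s := sub_nonneg.2 hs.2
  have hs0 := hs.1
  rcases le_total (1 / 2) s with h | h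
  · refine ⟨CFC.sqrt A, A ^ (s - 1 / 2) * B ^ (1 - s), hA',
      hsSq_rpow_mul_rpow_ne_top hA hB hA' hB' (by linarith) (by linarith) (by ring), ?_⟩
    rw [star_sqrt, CFC.sqrt_eq_rpow, ← mul_assoc,
      ← rpow_add_of_nonneg A (by norm_num) (by linarith), add_sub_cancel]
  · refine ⟨star (A ^ s * B ^ (1 / 2 - s)), CFC.sqrt B, ?_, hB', ?_⟩
    · rw [hsSq_star]
      exact hsSq_rpow_mul_rpow_ne_top hA hB hA' hB' (by linarith) (by linarith) (by ring)
    · rw [star_star, CFC.sqrt_eq_rpow, mul_assoc,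
        ← rpow_add_of_nonneg B (by linarith) (by norm_num)]
      congr 2
      ring

/-- `Tr[A^s B^(1-s)] = ‖A^(s/2) B^((1-s)/2)‖₂²`. -/
theorem trace_rpow_mul_rpow {A B : H →L[ℂ] H} (hA : 0 ≤ A) (hB : 0 ≤ B)
    (hA' : hsSq (CFC.sqrt A) ≠ ⊤) (hB' : hsSq (CFC.sqrt B) ≠ ⊤)
    {s : ℝ} (hs : s ∈ Set.Icc (0 : ℝ) 1) :
    trace (A ^ s * B ^ (1 - s)) =
      ((hsSq (CFC.sqrt (A ^ s) * CFC.sqrt (B ^ (1 - s)))).toReal : ℂ) := by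
  have h1 : 0 ≤ 1 - s := sub_nonneg.2 hs.2
  have hs0 := hs.1
  rw [sqrt_rpow_of_nonneg A hs.1, sqrt_rpow_of_nonneg B h1]
  have hQ : hsSq (star (A ^ (s / 2) * B ^ ((1 - s) / 2))) ≠ ⊤ := by
    rw [hsSq_star]
    exact hsSq_rpow_mul_rpow_ne_top hA hB hA' hB' (by linarith) (by linarith) (by ring)
  obtain ⟨ι, b, μ, hb⟩ := exists_eigenbasis hA hA'
  obtain ⟨X, Y, hX, hY, e⟩ := exists_rpow_mul_rpow_eq_star_mul hA hB hA' hB' hs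
  have hsum := hasSum_inner_star_mul b hX hY
  rw [← e] at hsum
  rw [e, trace_star_mul hX hY, ← hsSq_star, ← hsInner_self hQ]
  refine hsum.unique ?_
  -- The two series agree term by term in the eigenbasis of `A`: both terms are μᵢ^s ‖B^((1-s)/2)
  -- bᵢ‖².
  convert hasSum_hsInner b hQ hQ using 2 with i
  have hB2 : B ^ (1 - s) = star (B ^ ((1 - s) / 2)) * B ^ ((1 - s) / 2) := by
    rw [star_rpow, ← rpow_add_of_nonneg B (by linarith) (by linarith), add_halves]
  have hA2 : ((μ i : ℝ) ^ s : ℝ) = (μ i : ℝ) ^ (s / 2) * (μ i : ℝ) ^ (s / 2) := by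
    rw [← Real.rpow_add_of_nonneg (by positivity) (by linarith) (by linarith), add_halves]
  rw [mul_apply_eq_comp, ← ContinuousLinearMap.adjoint_inner_left,
    ← ContinuousLinearMap.star_eq_adjoint, star_rpow, rpow_apply_eigenvector hA (hb i) hs.1, hB2,
    inner_smul_left, inner_star_mul_self, star_mul, star_rpow, star_rpow, mul_apply_eq_comp,
    rpow_apply_eigenvector hA (hb i) (by linarith), map_smul, inner_smul_left, inner_smul_right,
    inner_self_eq_norm_sq_to_K, hA2]
  simp [mul_assoc]

end Weighted

/-! ### Tensor products of operators and of Hilbert bases. -/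

section TensorOperators

theorem hilbertTensor_coe_add {E F : Type*} [NormedAddCommGroup E] [InnerProductSpace ℂ E]
    [NormedAddCommGroup F] [InnerProductSpace ℂ F] (x y : E ⊗[ℂ] F) :
    ((x + y : E ⊗[ℂ] F) : HilbertTensor E F) = x + y :=
  UniformSpace.Completion.coe_add x y

theorem orthonormal_tensor {ι κ E F : Type*} [NormedAddCommGroup E] [InnerProductSpace ℂ E]
    [NormedAddCommGroup F] [InnerProductSpace ℂ F]
    (b : HilbertBasis ι ℂ E) (c : HilbertBasis κ ℂ F) :
    Orthonormal ℂ fun i : ι × κ => ((b i.1 ⊗ₜ[ℂ] c i.2 : E ⊗[ℂ] F) : HilbertTensor E F) := by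
  classical
  rw [orthonormal_iff_ite]
  intro i j
  rw [UniformSpace.Completion.inner_coe, TensorProduct.inner_tmul,
    orthonormal_iff_ite.1 b.orthonormal, orthonormal_iff_ite.1 c.orthonormal]
  by_cases h₁ : i.1 = j.1 <;> by_cases h₂ : i.2 = j.2 <;> simp [h₁, h₂, Prod.ext_iff]

variable {E : Type u} [NormedAddCommGroup E] [InnerProductSpace ℂ E] [CompleteSpace E]
variable {F : Type v} [NormedAddCommGroup F] [InnerProductSpace ℂ F] [CompleteSpace F]
variable {ι κ : Type*}

theorem opTensor_coe (A : E →L[ℂ] E) (B : F →L[ℂ] F) (x : E ⊗[ℂ] F) :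
    opTensor A B (x : HilbertTensor E F) =
      (TensorProduct.map A.toLinearMap B.toLinearMap x : E ⊗[ℂ] F) := by
  simp [opTensor]

theorem hilbertTensor_ext {S T : HilbertTensor E F →L[ℂ] HilbertTensor E F}
    (h : ∀ (x : E) (y : F), S ((x ⊗ₜ[ℂ] y : E ⊗[ℂ] F) : HilbertTensor E F) =
      T ((x ⊗ₜ[ℂ] y : E ⊗[ℂ] F) : HilbertTensor E F)) : S = T := by
  ext x
  induction x using UniformSpace.Completion.induction_on with
  | hp => exact isClosed_eq S.continuous T.continuous
  | ih x =>
    induction x using TensorProduct.induction_on with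
    | zero => rw [UniformSpace.Completion.coe_zero, map_zero, map_zero]
    | add x y hx hy => rw [hilbertTensor_coe_add, map_add, map_add, hx, hy]
    | tmul x y => exact h x y

theorem opTensor_mul (A C : E →L[ℂ] E) (B D : F →L[ℂ] F) :
    opTensor (A * C) (B * D) = opTensor A B * opTensor C D :=
  hilbertTensor_ext fun x y => by simp [opTensor_coe]

theorem opTensor_star (A : E →L[ℂ] E) (B : F →L[ℂ] F) :
    opTensor (star A) (star B) = star (opTensor A B) := by
  refine hilbertTensor_ext fun x y => ?_
  refine ext_inner_left ℂ fun z => ?_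
  rw [ContinuousLinearMap.star_eq_adjoint (opTensor A B), ContinuousLinearMap.adjoint_inner_right]
  induction z using UniformSpace.Completion.induction_on with
  | hp => exact isClosed_eq (by fun_prop) (by fun_prop)
  | ih z =>
    rw [opTensor_coe, opTensor_coe, UniformSpace.Completion.inner_coe,
      UniformSpace.Completion.inner_coe]
    induction z using TensorProduct.induction_on with
    | zero => simp
    | add z w hz hw => simp only [map_add, inner_add_left, hz, hw]
    | tmul z w =>
      simp [ContinuousLinearMap.star_eq_adjoint, ContinuousLinearMap.adjoint_inner_right]

theorem norm_opTensor_le (A : E →L[ℂ] E) (B : F →L[ℂ] F) : ‖opTensor A B‖ ≤ ‖A‖ * ‖B‖ := by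
  refine ContinuousLinearMap.opNorm_le_bound _ (by positivity) fun x => ?_
  induction x using UniformSpace.Completion.induction_on with
  | hp => exact isClosed_le (by fun_prop) (by fun_prop)
  | ih x =>
    rw [opTensor_coe, UniformSpace.Completion.norm_coe, UniformSpace.Completion.norm_coe]
    exact norm_map_le A B x

/-- The product of two Hilbert bases. -/
def tensorBasis (b : HilbertBasis ι ℂ E) (c : HilbertBasis κ ℂ F) :
    HilbertBasis (ι × κ) ℂ (HilbertTensor E F) :=
  HilbertBasis.mkOfOrthogonalEqBot (orthonormal_tensor b c) (by
    rw [Submodule.eq_bot_iff]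
    intro z hz
    rw [Submodule.mem_orthogonal] at hz
    let f : HilbertTensor E F →L[ℂ] ℂ := innerSL ℂ z
    -- The tensor product as a continuous bilinear map, so that orthogonality to products of basis
    -- vectors extends one variable at a time.
    let g : E →L[ℂ] F →L[ℂ] HilbertTensor E F :=
      (ContinuousLinearMap.compL ℂ F (E ⊗[ℂ] F) (HilbertTensor E F)
        UniformSpace.Completion.toComplL) ∘L TensorProduct.mkL ℂ E F
    have hg (x : E) (y : F) : g x y = ((x ⊗ₜ[ℂ] y : E ⊗[ℂ] F) : HilbertTensor E F) := rfl
    have h0 (i : ι) (y : F) : f (g (b i) y) = 0 := by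
      have : f ∘L g (b i) = 0 := by
        refine ContinuousLinearMap.ext_on
          (Submodule.dense_iff_topologicalClosure_eq_top.2 c.dense_span) ?_
        rintro _ ⟨j, rfl⟩
        exact inner_eq_zero_symm.1 (hz _ (Submodule.subset_span ⟨(i, j), rfl⟩))
      exact congrArg (fun T => T y) this
    have h1 (x : E) (y : F) : f (g x y) = 0 := by
      have : f ∘L (g.flip y) = 0 := by
        refine ContinuousLinearMap.ext_on
          (Submodule.dense_iff_topologicalClosure_eq_top.2 b.dense_span) ?_
        rintro _ ⟨i, rfl⟩
        exact h0 i y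
      exact congrArg (fun T => T x) this
    have h2 (w : HilbertTensor E F) : f w = 0 := by
      induction w using UniformSpace.Completion.induction_on with
      | hp => exact isClosed_eq f.continuous continuous_const
      | ih w =>
        induction w using TensorProduct.induction_on with
        | zero => rw [UniformSpace.Completion.coe_zero, map_zero]
        | add x y hx hy => rw [hilbertTensor_coe_add, map_add, hx, hy, add_zero]
        | tmul x y => exact h1 x y
    exact inner_self_eq_zero.1 (h2 z))

theorem tensorBasis_apply (b : HilbertBasis ι ℂ E) (c : HilbertBasis κ ℂ F) (i : ι × κ) :
    tensorBasis b c i = ((b i.1 ⊗ₜ[ℂ] c i.2 : E ⊗[ℂ] F) : HilbertTensor E F) := by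
  simp [tensorBasis, HilbertBasis.coe_mkOfOrthogonalEqBot]

theorem opTensor_tensorBasis (b : HilbertBasis ι ℂ E) (c : HilbertBasis κ ℂ F)
    (A : E →L[ℂ] E) (B : F →L[ℂ] F) (i : ι × κ) :
    opTensor A B (tensorBasis b c i) =
      ((A (b i.1) ⊗ₜ[ℂ] B (c i.2) : E ⊗[ℂ] F) : HilbertTensor E F) := by
  rw [tensorBasis_apply, opTensor_coe, TensorProduct.map_tmul]
  rfl

theorem hsSq_opTensor (A : E →L[ℂ] E) (B : F →L[ℂ] F) :
    hsSq (opTensor A B) = hsSq A * hsSq B := by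
  rw [hsSq_eq (tensorBasis (basis E) (basis F)), hsSq, hsSq, ENNReal.tsum_prod',
    ← ENNReal.tsum_mul_right]
  refine tsum_congr fun i => ?_
  rw [← ENNReal.tsum_mul_left]
  refine tsum_congr fun j => ?_
  rw [opTensor_tensorBasis, enorm_sq_eq_ofReal, enorm_sq_eq_ofReal, enorm_sq_eq_ofReal,
    UniformSpace.Completion.norm_coe, TensorProduct.norm_tmul, mul_pow,
    ENNReal.ofReal_mul (by positivity)]

theorem hsInner_opTensor {A C : E →L[ℂ] E} {B D : F →L[ℂ] F} (hA : hsSq A ≠ ⊤) (hB : hsSq B ≠ ⊤)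
    (hC : hsSq C ≠ ⊤) (hD : hsSq D ≠ ⊤) :
    hsInner (opTensor A B) (opTensor C D) = hsInner A C * hsInner B D := by
  have h := hasSum_hsInner (tensorBasis (basis E) (basis F)) (A := opTensor A B)
    (B := opTensor C D) (by rw [hsSq_opTensor]; exact ENNReal.mul_ne_top hA hB)
    (by rw [hsSq_opTensor]; exact ENNReal.mul_ne_top hC hD)
  simp only [opTensor_tensorBasis, UniformSpace.Completion.inner_coe,
    TensorProduct.inner_tmul] at h
  exact ((hasSum_hsInner (basis E) hA hC).mul_eq (hasSum_hsInner (basis F) hB hD) h).symm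

theorem rpow_eq_of_eigenbasis {S T : E →L[ℂ] E} (hT : 0 ≤ T) (b : HilbertBasis ι ℂ E)
    {μ : ι → ℝ≥0} (hb : ∀ i, T (b i) = ((μ i : ℝ) : ℂ) • b i) {s : ℝ} (hs : 0 ≤ s)
    (hS : ∀ i, S (b i) = (((μ i : ℝ) ^ s : ℝ) : ℂ) • b i) : T ^ s = S := by
  refine ContinuousLinearMap.ext_on
    (Submodule.dense_iff_topologicalClosure_eq_top.2 b.dense_span) ?_
  rintro _ ⟨i, rfl⟩
  rw [rpow_apply_eigenvector hT (hb i) hs, hS i]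

theorem opTensor_tensorBasis_of_eigenvector (b : HilbertBasis ι ℂ E) (c : HilbertBasis κ ℂ F)
    {A : E →L[ℂ] E} {B : F →L[ℂ] F} {i : ι × κ} {μ ν : ℂ} (hA : A (b i.1) = μ • b i.1)
    (hB : B (c i.2) = ν • c i.2) :
    opTensor A B (tensorBasis b c i) = (μ * ν) • tensorBasis b c i := by
  rw [opTensor_tensorBasis, tensorBasis_apply, hA, hB, TensorProduct.smul_tmul_smul]
  exact UniformSpace.Completion.coe_smul _ _

end TensorOperators

/-! ### Multiplicativity under tensor powers. -/

section Powers

variable {H : Type u} [NormedAddCommGroup H] [InnerProductSpace ℂ H] [CompleteSpace H]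

theorem opPower_succ (A : H →L[ℂ] H) (n : ℕ) :
    opPower A (n + 1) = opTensor (opPower A n) A := rfl

theorem opPower_mul (A B : H →L[ℂ] H) (n : ℕ) : opPower (A * B) n = opPower A n * opPower B n := by
  induction n with
  | zero => exact (mul_one _).symm
  | succ n ih => rw [opPower_succ, ih]; exact opTensor_mul _ _ _ _

theorem opPower_star (A : H →L[ℂ] H) (n : ℕ) : opPower (star A) n = star (opPower A n) := by
  induction n with
  | zero => exact star_one _ |>.symm
  | succ n ih => rw [opPower_succ, ih]; exact opTensor_star _ _

theorem opPower_nonneg {A : H →L[ℂ] H} (hA : 0 ≤ A) (n : ℕ) : 0 ≤ opPower A n := by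
  obtain ⟨C, rfl⟩ := CStarAlgebra.nonneg_iff_eq_star_mul_self (A := H →L[ℂ] H) |>.1 hA
  rw [opPower_mul, opPower_star]
  exact star_mul_self_nonneg _

theorem norm_opPower_le_one {A : H →L[ℂ] H} (hA : ‖A‖ ≤ 1) (n : ℕ) : ‖opPower A n‖ ≤ 1 := by
  induction n with
  | zero => exact ContinuousLinearMap.norm_id_le
  | succ n ih => exact (norm_opTensor_le _ _).trans (mul_le_one₀ ih (norm_nonneg _) hA)

theorem hsSq_one_euclideanSpace :
    hsSq (1 : EuclideanSpace ℂ PUnit.{u + 1} →L[ℂ] EuclideanSpace ℂ PUnit.{u + 1}) = 1 := by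
  rw [hsSq_eq (EuclideanSpace.basisFun PUnit.{u + 1} ℂ).toHilbertBasis]
  simp [enorm_sq_eq_ofReal]

theorem hsSq_opPower (A : H →L[ℂ] H) (n : ℕ) : hsSq (opPower A n) = hsSq A ^ n := by
  induction n with
  | zero => exact hsSq_one_euclideanSpace.trans (pow_zero _).symm
  | succ n ih => rw [pow_succ, ← ih]; exact hsSq_opTensor _ _

theorem hsInner_opPower {A B : H →L[ℂ] H} (hA : hsSq A ≠ ⊤) (hB : hsSq B ≠ ⊤) (n : ℕ) :
    hsInner (opPower A n) (opPower B n) = hsInner A B ^ n := by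
  induction n with
  | zero =>
    have h : hsSq (opPower A 0) = 1 := hsSq_one_euclideanSpace
    change hsInner (opPower A 0) (opPower A 0) = _
    rw [hsInner_self (by simp [h]), h]
    simp
  | succ n ih =>
    rw [pow_succ, ← ih]
    exact hsInner_opTensor (by rw [hsSq_opPower]; exact ENNReal.pow_ne_top hA) hA
      (by rw [hsSq_opPower]; exact ENNReal.pow_ne_top hB) hB

theorem sqrt_opPower {A : H →L[ℂ] H} (hA : 0 ≤ A) (n : ℕ) :
    CFC.sqrt (opPower A n) = opPower (CFC.sqrt A) n :=
  CFC.sqrt_unique (by rw [← opPower_mul, CFC.sqrt_mul_sqrt_self A])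
    (opPower_nonneg (CFC.sqrt_nonneg A) n)

theorem hsSq_sqrt_opPower {A : H →L[ℂ] H} (hA : 0 ≤ A) (n : ℕ) :
    hsSq (CFC.sqrt (opPower A n)) = hsSq (CFC.sqrt A) ^ n := by
  rw [sqrt_opPower hA, hsSq_opPower]

/-- The product of eigenbases of A^{⊗n} and A is an eigenbasis of A^{⊗(n+1)} with product
eigenvalues, and x ↦ x^s is multiplicative. -/
theorem opPower_rpow {A : H →L[ℂ] H} (hA : 0 ≤ A) (hA' : hsSq (CFC.sqrt A) ≠ ⊤) {s : ℝ}
    (hs : 0 ≤ s) (n : ℕ) : opPower A n ^ s = opPower (A ^ s) n := by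
  induction n with
  | zero => exact CFC.one_rpow
  | succ n ih =>
    have hn : hsSq (CFC.sqrt (opPower A n)) ≠ ⊤ := by
      rw [hsSq_sqrt_opPower hA]
      exact ENNReal.pow_ne_top hA'
    obtain ⟨ι, b, μ, hb⟩ := exists_eigenbasis (opPower_nonneg hA n) hn
    obtain ⟨κ, c, ν, hc⟩ := exists_eigenbasis hA hA'
    refine rpow_eq_of_eigenbasis (E := (tensorPower H (n + 1)).carrier)
      (opPower_nonneg hA (n + 1)) (tensorBasis b c) (μ := fun i => μ i.1 * ν i.2) (fun i => ?_) hs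
      (fun i => ?_)
    · refine (opTensor_tensorBasis_of_eigenvector b c (hb i.1) (hc i.2)).trans ?_
      rw [NNReal.coe_mul, Complex.ofReal_mul]
      rfl
    · rw [opPower_succ, ← ih]
      refine (opTensor_tensorBasis_of_eigenvector b c
        (rpow_apply_eigenvector (opPower_nonneg hA n) (hb i.1) hs)
        (rpow_apply_eigenvector hA (hc i.2) hs)).trans ?_
      rw [NNReal.coe_mul, Real.mul_rpow (by positivity) (by positivity), Complex.ofReal_mul]
      rfl

end Powers

/-! ### Polar decomposition, fidelity, Bures distance, and the error bound for a single test. -/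

section Fidelity

variable {H : Type u} [NormedAddCommGroup H] [InnerProductSpace ℂ H] [CompleteSpace H]

/-- Polar decomposition, with a contraction in place of the partial isometry. -/
theorem exists_polar (T : H →L[ℂ] H) :
    ∃ W : H →L[ℂ] H, ‖W‖ ≤ 1 ∧ W * CFC.sqrt (star T * T) = T ∧
      star W * T = CFC.sqrt (star T * T) := by
  set P := CFC.sqrt (star T * T) with hP
  have hPP : star P * P = star T * T := by
    rw [hP, star_sqrt, CFC.sqrt_mul_sqrt_self _ (star_mul_self_nonneg T)]
  have hin (x y : H) : ⟪T x, T y⟫_ℂ = ⟪P x, P y⟫_ℂ := by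
    rw [← ContinuousLinearMap.adjoint_inner_right, ← ContinuousLinearMap.adjoint_inner_right,
      ← ContinuousLinearMap.star_eq_adjoint, ← ContinuousLinearMap.star_eq_adjoint,
      ← mul_apply_eq_comp, ← mul_apply_eq_comp, hPP]
  have hnorm (x : H) : ‖T x‖ ≤ 1 * ‖P x‖ := by
    rw [one_mul, norm_eq_sqrt_re_inner (𝕜 := ℂ), hin, ← norm_eq_sqrt_re_inner]
  -- Since ‖Tx‖ = ‖Px‖, the map Px ↦ Tx is well defined and extends to the closure `K` of the range
  -- of `P`; the contraction is this extension after the projection onto `K`.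
  let K := (LinearMap.range P.toLinearMap).topologicalClosure
  have hK (x : H) : P x ∈ K := Submodule.le_topologicalClosure _ ⟨x, rfl⟩
  let e : H →ₗ[ℂ] K := P.toLinearMap.codRestrict K hK
  have hd : DenseRange e := by
    have h : Set.range e = Subtype.val ⁻¹' (Set.range P) := by
      ext k
      simp [e, Subtype.ext_iff]
    rw [DenseRange, h, Subtype.dense_iff]
    intro k hk
    refine closure_mono ?_ hk
    rintro _ ⟨x, rfl⟩
    exact ⟨⟨P x, hK x⟩, ⟨x, rfl⟩, rfl⟩
  have : CompleteSpace K := (Submodule.isClosed_topologicalClosure _).completeSpace_coe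
  let V : K →L[ℂ] H := T.toLinearMap.extendOfNorm e
  have hV (x : H) : V ⟨P x, hK x⟩ = T x :=
    LinearMap.extendOfNorm_eq (f := T.toLinearMap) hd ⟨1, hnorm⟩ x
  have hVn : ‖V‖ ≤ 1 := LinearMap.opNorm_extendOfNorm_le hd zero_le_one hnorm
  refine ⟨V ∘L K.orthogonalProjectionOnto, ?_, ?_, ?_⟩
  · refine (ContinuousLinearMap.opNorm_comp_le _ _).trans ?_
    exact mul_le_one₀ hVn (norm_nonneg _) K.orthogonalProjectionOnto_norm_le
  · ext x
    have := K.orthogonalProjectionOnto_mem_subspace_eq_self ⟨P x, hK x⟩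
    rw [mul_apply_eq_comp, ContinuousLinearMap.comp_apply]
    exact (congrArg V this).trans (hV x)
  · ext x
    refine ext_inner_right ℂ fun y => ?_
    rw [ContinuousLinearMap.star_eq_adjoint, mul_apply_eq_comp,
      ContinuousLinearMap.adjoint_inner_left, ContinuousLinearMap.comp_apply]
    have h1 (k : K) : ⟪T x, V k⟫_ℂ = ⟪P x, (k : H)⟫_ℂ := by
      refine hd.induction_on (p := fun k : K => ⟪T x, V k⟫_ℂ = ⟪P x, (k : H)⟫_ℂ) k
        (isClosed_eq (by fun_prop) (by fun_prop)) fun z => ?_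
      exact (congrArg _ (hV z)).trans (hin x z)
    rw [h1]
    exact Submodule.inner_orthogonalProjectionOnto_eq_of_mem_left ⟨P x, hK x⟩ y

/-- The diagonal entries of A†B are nonnegative and their series converges to `hsInner A B`, so A†B
has finite trace. -/
theorem posTrace_star_mul {A B : H →L[ℂ] H} (hA : hsSq A ≠ ⊤) (hB : hsSq B ≠ ⊤)
    (h : 0 ≤ star A * B) :
    hsSq (CFC.sqrt (star A * B)) ≠ ⊤ ∧ hsInner A B = (hsSq (CFC.sqrt (star A * B))).toReal := by
  have hs := hasSum_inner_star_mul (basis H) hA hB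
  have e : star A * B = star (CFC.sqrt (star A * B)) * CFC.sqrt (star A * B) := by
    rw [star_sqrt, CFC.sqrt_mul_sqrt_self _ h]
  rw [e] at hs
  simp only [inner_star_mul_self] at hs
  have hre := (Complex.hasSum_iff _ _).1 hs
  simp only [Complex.ofReal_re, Complex.ofReal_im] at hre
  have h1 : hsSq (CFC.sqrt (star A * B)) = ENNReal.ofReal (hsInner A B).re := by
    rw [← hre.1.tsum_eq, ENNReal.ofReal_tsum_of_nonneg (fun _ => by positivity) hre.1.summable]
    exact tsum_congr fun i => enorm_sq_eq_ofReal _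
  refine ⟨by simp [h1], ?_⟩
  rw [h1, ENNReal.toReal_ofReal (hre.1.nonneg fun _ => by positivity)]
  exact Complex.ext (by simp) (by simpa using hre.2.unique hasSum_zero)

theorem schattenNorm_one (T : H →L[ℂ] H) :
    schattenNorm 1 T = hsSq (CFC.sqrt (CFC.sqrt (star T * T))) := by
  have h : (star T * T) ^ ((1 : ℝ) / 2) = CFC.sqrt (star T * T) := CFC.sqrt_eq_rpow.symm
  rw [schattenNorm, h, one_div_one, ENNReal.rpow_one,
    posTrace_eq_hsSq_sqrt (CFC.sqrt_nonneg (star T * T))]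

theorem schattenNorm_two (T : H →L[ℂ] H) : schattenNorm 2 T = hsSq T ^ (1 / 2 : ℝ) := by
  rw [schattenNorm, div_self two_ne_zero, CFC.rpow_one _ (star_mul_self_nonneg T),
    posTrace_star_mul_self]

/-- The trace norm of a product of two Hilbert-Schmidt operators is attained by a contraction. -/
theorem exists_hsInner_eq_schattenNorm {R S : H →L[ℂ] H} (hR : hsSq R ≠ ⊤) (hS : hsSq S ≠ ⊤) :
    ∃ W : H →L[ℂ] H, ‖W‖ ≤ 1 ∧
      hsInner (R * W) S = ((schattenNorm 1 (star R * S)).toReal : ℂ) := by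
  obtain ⟨W, hW, -, hWT⟩ := exists_polar (star R * S)
  have e : star (R * W) * S = CFC.sqrt (star (star R * S) * (star R * S)) := by
    rw [star_mul, mul_assoc, hWT]
  have h := posTrace_star_mul (hsSq_mul_ne_top_right hR W) hS (by rw [e]; exact CFC.sqrt_nonneg _)
  exact ⟨W, hW, by rw [h.2, schattenNorm_one, e]⟩

/-- With R†S = WP polar, Tr[U†WP] = ⟨√P W†U, √P⟩, and Cauchy-Schwarz bounds this by Tr P because W†U
is a contraction. -/
theorem norm_hsInner_mul_le_schattenNorm {R S : H →L[ℂ] H} (hR : hsSq R ≠ ⊤) (hS : hsSq S ≠ ⊤)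
    {U : H →L[ℂ] H} (hU : ‖U‖ ≤ 1) :
    ‖hsInner (R * U) S‖ ≤ (schattenNorm 1 (star R * S)).toReal := by
  obtain ⟨W, hW, hWP, hWT⟩ := exists_polar (star R * S)
  have e : star (R * W) * S = CFC.sqrt (star (star R * S) * (star R * S)) := by
    rw [star_mul, mul_assoc, hWT]
  have hfin := (posTrace_star_mul (hsSq_mul_ne_top_right hR W) hS
    (by rw [e]; exact CFC.sqrt_nonneg _)).1
  rw [e] at hfin
  rw [schattenNorm_one]
  set P := CFC.sqrt (star (star R * S) * (star R * S)) with hP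
  have hP0 : 0 ≤ P := CFC.sqrt_nonneg _
  have hRU := hsSq_mul_ne_top_right hR U
  have hX := hsSq_mul_ne_top_right hfin (star W * U)
  have e2 : hsInner (R * U) S = hsInner (CFC.sqrt P * (star W * U)) (CFC.sqrt P) := by
    rw [← trace_star_mul hRU hS, ← trace_star_mul hX hfin, star_mul, mul_assoc, ← hWP, star_mul,
      star_mul, star_star, star_sqrt, mul_assoc, mul_assoc, CFC.sqrt_mul_sqrt_self P hP0]
  have hWU : ‖star W * U‖ ≤ 1 :=
    (norm_mul_le _ _).trans (mul_le_one₀ (by rwa [norm_star]) (norm_nonneg _) hU)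
  rw [e2]
  refine (norm_hsInner_le hX hfin).trans ?_
  refine (mul_le_mul_of_nonneg_right (Real.sqrt_le_sqrt (ENNReal.toReal_mono hfin
    (hsSq_mul_le_of_norm_le_one_right _ hWU))) (Real.sqrt_nonneg _)).trans_eq ?_
  exact Real.mul_self_sqrt ENNReal.toReal_nonneg

theorem hsInner_add_right {A B C : H →L[ℂ] H} (hA : hsSq A ≠ ⊤) (hB : hsSq B ≠ ⊤)
    (hC : hsSq C ≠ ⊤) : hsInner A (B + C) = hsInner A B + hsInner A C := by
  have h := (hasSum_hsInner (basis H) hA hB).add (hasSum_hsInner (basis H) hA hC)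
  refine (hasSum_hsInner (basis H) hA (hsSq_add_ne_top hB hC)).unique ?_
  simpa only [add_apply, inner_add_right] using h

theorem IsState.hsSq_sqrt {ρ : H →L[ℂ] H} (hρ : IsState ρ) : hsSq (CFC.sqrt ρ) = 1 := by
  have h : trace ρ = ∑' i, ((‖CFC.sqrt ρ (basis H i)‖ ^ 2 : ℝ) : ℂ) := by
    refine tsum_congr fun i => ?_
    rw [← inner_star_mul_self, star_sqrt, CFC.sqrt_mul_sqrt_self ρ hρ.nonneg]
  rw [hρ.trace_eq_one, ← Complex.ofReal_tsum, eq_comm, Complex.ofReal_eq_one] at h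
  have hs : Summable fun i => ‖CFC.sqrt ρ (basis H i)‖ ^ 2 := by
    -- A divergent `tsum` has value 0, so trace one forces convergence.
    by_contra hn
    rw [tsum_eq_zero_of_not_summable hn] at h
    exact zero_ne_one h
  rw [hsSq, tsum_congr fun i => enorm_sq_eq_ofReal (CFC.sqrt ρ (basis H i)),
    ← ENNReal.ofReal_tsum_of_nonneg (fun _ => by positivity) hs, h, ENNReal.ofReal_one]

theorem toReal_hsSq_sub {A B : H →L[ℂ] H} (hA : hsSq A ≠ ⊤) (hB : hsSq B ≠ ⊤) :
    (hsSq (A - B)).toReal = (hsSq A).toReal - 2 * (hsInner A B).re + (hsSq B).toReal := by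
  let X : lp (fun _ : basisIndex H => H) 2 := ⟨_, memℓp_of_hsSq_ne_top (basis H) hA⟩
  let Y : lp (fun _ : basisIndex H => H) 2 := ⟨_, memℓp_of_hsSq_ne_top (basis H) hB⟩
  have h₁ : (hsSq (A - B)).toReal = ‖X - Y‖ ^ 2 :=
    toReal_hsSq (basis H) (hsSq_sub_ne_top hA hB)
  have h₂ : (hsSq A).toReal = ‖X‖ ^ 2 := toReal_hsSq (basis H) hA
  have h₃ : (hsSq B).toReal = ‖Y‖ ^ 2 := toReal_hsSq (basis H) hB
  have h₄ : hsInner A B = ⟪X, Y⟫_ℂ := hsInner_eq_inner_lp (basis H) hA hB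
  rw [h₁, h₂, h₃, h₄, norm_sub_sq (𝕜 := ℂ) X Y]
  rfl

theorem norm_unitary_le_one (U : unitary (H →L[ℂ] H)) : ‖(U : H →L[ℂ] H)‖ ≤ 1 := by
  have := CStarRing.norm_coe_unitary_mul U (1 : H →L[ℂ] H)
  rw [mul_one] at this
  exact this.trans_le ContinuousLinearMap.norm_id_le

/-- Expanding the square, each unitary gives ‖√ρ - U√σ‖₂² ≥ 2 - 2‖√ρ√σ‖₁, which passes to the
infimum. Only this half of the Bures-fidelity formula is needed. -/
theorem one_sub_buresDist_sq_le {ρ σ : H →L[ℂ] H} (hρ : IsState ρ) (hσ : IsState σ) :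
    1 - buresDist ρ σ ^ 2 / 2 ≤ (schattenNorm 1 (CFC.sqrt ρ * CFC.sqrt σ)).toReal := by
  set f := (schattenNorm 1 (CFC.sqrt ρ * CFC.sqrt σ)).toReal with hf
  have hR : hsSq (CFC.sqrt ρ) ≠ ⊤ := by simp [hρ.hsSq_sqrt]
  have hS : hsSq (CFC.sqrt σ) ≠ ⊤ := by simp [hσ.hsSq_sqrt]
  have hfin (U : unitary (H →L[ℂ] H)) :
      schattenNorm 2 (CFC.sqrt ρ - (U : H →L[ℂ] H) * CFC.sqrt σ) ≠ ⊤ := by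
    rw [schattenNorm_two]
    exact ENNReal.rpow_ne_top_of_nonneg (by norm_num)
      (hsSq_sub_ne_top hR (hsSq_mul_ne_top_left _ hS))
  have hU (U : unitary (H →L[ℂ] H)) : ENNReal.ofReal √(2 - 2 * f) ≤
      schattenNorm 2 (CFC.sqrt ρ - (U : H →L[ℂ] H) * CFC.sqrt σ) := by
    have hSU := hsSq_mul_ne_top_right hS (star (U : H →L[ℂ] H))
    -- Taking adjoints moves the unitary to the right, where the trace-norm bound applies.
    have e1 : hsSq (CFC.sqrt ρ - (U : H →L[ℂ] H) * CFC.sqrt σ) =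
        hsSq (CFC.sqrt ρ - CFC.sqrt σ * star (U : H →L[ℂ] H)) := by
      rw [← hsSq_star, star_sub, star_mul, star_sqrt, star_sqrt]
    have e2 : 1 ≤ (hsSq (CFC.sqrt σ * star (U : H →L[ℂ] H))).toReal := by
      have h := hsSq_mul_le_of_norm_le_one_right (CFC.sqrt σ * star (U : H →L[ℂ] H))
        (norm_unitary_le_one U)
      rw [mul_assoc, Unitary.coe_star_mul_self, mul_one, hσ.hsSq_sqrt] at h
      simpa using ENNReal.toReal_mono hSU h
    have e3 : (hsInner (CFC.sqrt ρ) (CFC.sqrt σ * star (U : H →L[ℂ] H))).re ≤ f := by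
      rw [← hsInner_mul_right _ _ _ hR hS]
      have h := norm_hsInner_mul_le_schattenNorm hR hS (norm_unitary_le_one U)
      rw [star_sqrt] at h
      exact (Complex.re_le_norm _).trans h
    have e4 := toReal_hsSq_sub hR hSU
    rw [hρ.hsSq_sqrt, ENNReal.toReal_one] at e4
    rw [schattenNorm_two, e1, ← ENNReal.ofReal_toReal (hsSq_sub_ne_top hR hSU),
      ENNReal.ofReal_rpow_of_nonneg ENNReal.toReal_nonneg (by norm_num), ← Real.sqrt_eq_rpow]
    exact ENNReal.ofReal_le_ofReal (Real.sqrt_le_sqrt (by linarith))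
  have h := ENNReal.toReal_mono (ne_top_of_le_ne_top (hfin 1) (iInf_le _ 1)) (le_iInf hU)
  rw [ENNReal.toReal_ofReal (Real.sqrt_nonneg _)] at h
  have h' := (Real.sqrt_le_iff.1 h).2
  change 2 - 2 * f ≤ buresDist ρ σ ^ 2 at h'
  linarith

theorem trace_mul_of_nonneg {ρ Λ : H →L[ℂ] H} (hρ : 0 ≤ ρ) (hρ' : hsSq (CFC.sqrt ρ) ≠ ⊤)
    (hΛ : 0 ≤ Λ) : trace (Λ * ρ) = ((hsSq (CFC.sqrt Λ * CFC.sqrt ρ)).toReal : ℂ) := by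
  have hX := hsSq_mul_ne_top_left (CFC.sqrt Λ) hρ'
  have e : Λ * ρ = star (CFC.sqrt ρ * Λ) * CFC.sqrt ρ := by
    rw [star_mul, star_sqrt, hΛ.isSelfAdjoint.star_eq, mul_assoc, CFC.sqrt_mul_sqrt_self ρ]
  rw [e, trace_star_mul (hsSq_mul_ne_top_right hρ' Λ) hρ', ← hsInner_star_star, star_mul, star_sqrt,
    hΛ.isSelfAdjoint.star_eq, ← hsInner_self hX, hsInner_mul_left _ _ _ hρ' hX, star_sqrt,
    ← mul_assoc, CFC.sqrt_mul_sqrt_self Λ]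

/-- Expectations of the effects `Λ` and `1 - Λ` in a normalized state. -/
theorem trace_effect {ρ Λ : H →L[ℂ] H} (hρ : 0 ≤ ρ) (hρ' : hsSq (CFC.sqrt ρ) = 1)
    (hΛ : 0 ≤ Λ) (hΛ' : Λ ≤ 1) :
    (trace (Λ * ρ)).re = (hsSq (CFC.sqrt Λ * CFC.sqrt ρ)).toReal ∧
      (trace ((1 - Λ) * ρ)).re = (hsSq (CFC.sqrt (1 - Λ) * CFC.sqrt ρ)).toReal ∧
      (hsSq (CFC.sqrt Λ * CFC.sqrt ρ)).toReal +
        (hsSq (CFC.sqrt (1 - Λ) * CFC.sqrt ρ)).toReal = 1 := by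
  have hfin : hsSq (CFC.sqrt ρ) ≠ ⊤ := by simp [hρ']
  refine ⟨by rw [trace_mul_of_nonneg hρ hfin hΛ, Complex.ofReal_re],
    by rw [trace_mul_of_nonneg hρ hfin (sub_nonneg.2 hΛ'), Complex.ofReal_re], ?_⟩
  rw [← ENNReal.toReal_add (hsSq_mul_ne_top_left _ hfin) (hsSq_mul_ne_top_left _ hfin),
    ← hsSq_sqrt_add_mul hΛ (sub_nonneg.2 hΛ'), add_sub_cancel, CFC.sqrt_one, one_mul, hρ',
    ENNReal.toReal_one]

/-- Split S = ΛS + (1 - Λ)S. For each effect M, ⟨RW, MS⟩ = ⟨√M R W, √M S⟩; Cauchy-Schwarz applies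
and the contraction W, on the far right, is dropped. -/
theorem norm_hsInner_le_of_effect {R S Λ W : H →L[ℂ] H} (hR : hsSq R ≠ ⊤) (hS : hsSq S ≠ ⊤)
    (hΛ : 0 ≤ Λ) (hΛ' : Λ ≤ 1) (hW : ‖W‖ ≤ 1) :
    ‖hsInner (R * W) S‖ ≤
      √(hsSq (CFC.sqrt Λ * R)).toReal * √(hsSq (CFC.sqrt Λ * S)).toReal +
        √(hsSq (CFC.sqrt (1 - Λ) * R)).toReal * √(hsSq (CFC.sqrt (1 - Λ) * S)).toReal := by
  have hRW := hsSq_mul_ne_top_right hR W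
  have key {M : H →L[ℂ] H} (hM : 0 ≤ M) : ‖hsInner (R * W) (M * S)‖ ≤
      √(hsSq (CFC.sqrt M * R)).toReal * √(hsSq (CFC.sqrt M * S)).toReal := by
    have hMS := hsSq_mul_ne_top_left (CFC.sqrt M) hS
    have hMR := hsSq_mul_ne_top_left (CFC.sqrt M) hR
    have e : hsInner (R * W) (M * S) = hsInner (CFC.sqrt M * R * W) (CFC.sqrt M * S) := by
      rw [mul_assoc, hsInner_mul_left _ _ _ hRW hMS, star_sqrt, ← mul_assoc,
        CFC.sqrt_mul_sqrt_self M]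
    rw [e]
    refine (norm_hsInner_le (hsSq_mul_ne_top_right hMR W) hMS).trans ?_
    gcongr
    exact hsSq_mul_le_of_norm_le_one_right _ hW
  have e : S = Λ * S + (1 - Λ) * S := by rw [← add_mul, add_sub_cancel, one_mul]
  rw [e, hsInner_add_right hRW (hsSq_mul_ne_top_left _ hS) (hsSq_mul_ne_top_left _ hS), ← e]
  exact (norm_add_le _ _).trans (add_le_add (key hΛ) (key (sub_nonneg.2 hΛ')))

/-- Every test satisfies `p q F ≤ e (1 - e)`, where `e` is its error probability. -/
theorem mul_norm_hsInner_sq_le {ρ σ Λ W : H →L[ℂ] H} {p q : ℝ} (hp : 0 ≤ p) (hq : 0 ≤ q)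
    (hpq : p + q = 1) (hρ : 0 ≤ ρ) (hσ : 0 ≤ σ) (hρ' : hsSq (CFC.sqrt ρ) = 1)
    (hσ' : hsSq (CFC.sqrt σ) = 1) (hΛ : 0 ≤ Λ) (hΛ' : Λ ≤ 1) (hW : ‖W‖ ≤ 1) :
    p * q * ‖hsInner (CFC.sqrt ρ * W) (CFC.sqrt σ)‖ ^ 2 ≤
      (p * (trace ((1 - Λ) * ρ)).re + q * (trace (Λ * σ)).re) *
        (1 - (p * (trace ((1 - Λ) * ρ)).re + q * (trace (Λ * σ)).re)) := by
  obtain ⟨-, h₁, h₂⟩ := trace_effect hρ hρ' hΛ hΛ'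
  obtain ⟨h₃, -, h₄⟩ := trace_effect hσ hσ' hΛ hΛ'
  have h := norm_hsInner_le_of_effect (R := CFC.sqrt ρ) (S := CFC.sqrt σ) (by simp [hρ'])
    (by simp [hσ']) hΛ hΛ' hW
  rw [h₁, h₃]
  have ht := norm_nonneg (hsInner (CFC.sqrt ρ * W) (CFC.sqrt σ))
  generalize ‖hsInner (CFC.sqrt ρ * W) (CFC.sqrt σ)‖ = t at *
  have hsq (x : ℝ≥0∞) : x.toReal = √x.toReal ^ 2 := (Real.sq_sqrt ENNReal.toReal_nonneg).symm
  rw [hsq (hsSq (CFC.sqrt Λ * CFC.sqrt ρ)), hsq (hsSq (CFC.sqrt (1 - Λ) * CFC.sqrt ρ))] at h₂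
  rw [hsq (hsSq (CFC.sqrt Λ * CFC.sqrt σ)), hsq (hsSq (CFC.sqrt (1 - Λ) * CFC.sqrt σ))] at h₄
  rw [hsq (hsSq (CFC.sqrt (1 - Λ) * CFC.sqrt ρ)), hsq (hsSq (CFC.sqrt Λ * CFC.sqrt σ))]
  generalize √(hsSq (CFC.sqrt Λ * CFC.sqrt ρ)).toReal = a at *
  generalize √(hsSq (CFC.sqrt (1 - Λ) * CFC.sqrt ρ)).toReal = a' at *
  generalize √(hsSq (CFC.sqrt Λ * CFC.sqrt σ)).toReal = b at *
  generalize √(hsSq (CFC.sqrt (1 - Λ) * CFC.sqrt σ)).toReal = b' at *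
  have h5 : 1 - (p * a' ^ 2 + q * b ^ 2) = p * a ^ 2 + q * b' ^ 2 := by
    linear_combination -hpq - p * h₂ - q * h₄
  have h6 : t ^ 2 ≤ (a * b + a' * b') ^ 2 := pow_le_pow_left₀ ht h 2
  rw [h5]
  calc p * q * t ^ 2 ≤ p * q * (a * b + a' * b') ^ 2 := by gcongr
    -- The difference of the two sides is exactly (p a a' - q b b')².
    _ ≤ (p * a' ^ 2 + q * b ^ 2) * (p * a ^ 2 + q * b' ^ 2) := by
      nlinarith [sq_nonneg (p * (a * a') - q * (b * b'))]

end Fidelity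

/-! ### The projective test attaining the Chernoff bound. -/

section ChernoffTest

variable {H : Type u} [NormedAddCommGroup H] [InnerProductSpace ℂ H] [CompleteSpace H]

theorem sqrt_real_smul {A : H →L[ℂ] H} (hA : 0 ≤ A) {c : ℝ} (hc : 0 ≤ c) :
    CFC.sqrt (c • A) = √c • CFC.sqrt A :=
  CFC.sqrt_unique (by rw [smul_mul_smul_comm, Real.mul_self_sqrt hc, CFC.sqrt_mul_sqrt_self A])
    (smul_nonneg (Real.sqrt_nonneg c) (CFC.sqrt_nonneg A))

theorem hsSq_sqrt_smul {A : H →L[ℂ] H} {c : ℝ} (hc : 0 ≤ c) :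
    hsSq (√c • A) = ENNReal.ofReal c * hsSq A := by
  rw [hsSq, hsSq, ← ENNReal.tsum_mul_left]
  refine tsum_congr fun i => ?_
  rw [enorm_sq_eq_ofReal, enorm_sq_eq_ofReal, smul_apply, norm_smul, mul_pow, Real.norm_eq_abs,
    sq_abs, Real.sq_sqrt hc, ENNReal.ofReal_mul hc]

theorem real_smul_rpow {A : H →L[ℂ] H} (hA : 0 ≤ A) (hA' : hsSq (CFC.sqrt A) ≠ ⊤) {c s : ℝ}
    (hc : 0 ≤ c) (hs : 0 ≤ s) : (c • A) ^ s = (c ^ s) • A ^ s := by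
  obtain ⟨ι, b, μ, hb⟩ := exists_eigenbasis hA hA'
  lift c to ℝ≥0 using hc
  refine rpow_eq_of_eigenbasis (smul_nonneg c.2 hA) b (μ := fun i => c * μ i) (fun i => ?_) hs
    fun i => ?_
  · rw [smul_apply, hb, NNReal.coe_mul, Complex.ofReal_mul, mul_smul, ← Complex.coe_smul]
    rfl
  · rw [smul_apply, rpow_apply_eigenvector hA (hb i) hs, NNReal.coe_mul,
      Real.mul_rpow (by positivity) (by positivity), Complex.ofReal_mul, mul_smul,
      ← Complex.coe_smul]

/-- The projection onto the closure of the range of `D₊` extracts the positive part of `D`. -/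
theorem exists_effect_mul_eq_posPart {D : H →L[ℂ] H} (hD : IsSelfAdjoint D) :
    ∃ Λ : H →L[ℂ] H, 0 ≤ Λ ∧ Λ ≤ 1 ∧ Λ * D = D⁺ := by
  let K := (LinearMap.range (D⁺).toLinearMap).topologicalClosure
  have : CompleteSpace K := (Submodule.isClosed_topologicalClosure _).completeSpace_coe
  have hP : IsStarProjection K.starProjection := isStarProjection_starProjection
  refine ⟨K.starProjection, hP.nonneg, sub_nonneg.1 hP.one_sub.nonneg, ?_⟩
  have h₁ : K.starProjection * D⁺ = D⁺ := by
    ext x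
    rw [mul_apply_eq_comp]
    exact Submodule.starProjection_eq_self_iff.2 (Submodule.le_topologicalClosure _ ⟨x, rfl⟩)
  -- D₊D₋ = 0 makes the ranges of D₊ and D₋ orthogonal.
  have h₂ : K.starProjection * D⁻ = 0 := by
    ext x
    rw [mul_apply_eq_comp]
    refine K.starProjection_apply_eq_zero_iff.2 ?_
    rw [Submodule.orthogonal_closure, Submodule.mem_orthogonal]
    rintro _ ⟨y, rfl⟩
    have hsa : star (D⁺) = D⁺ := (CFC.posPart_nonneg D).isSelfAdjoint.star_eq
    change ⟪D⁺ y, D⁻ x⟫_ℂ = 0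
    rw [← ContinuousLinearMap.adjoint_inner_right, ← ContinuousLinearMap.star_eq_adjoint, hsa,
      ← mul_apply_eq_comp, CFC.posPart_mul_negPart]
    simp
  conv_lhs => rw [← CFC.posPart_sub_negPart D hD, mul_sub, h₁, h₂, sub_zero]

theorem hasSum_trace_mul {ρ : H →L[ℂ] H} (hρ : 0 ≤ ρ) (hρ' : hsSq (CFC.sqrt ρ) ≠ ⊤)
    (Λ : H →L[ℂ] H) :
    HasSum (fun i => ⟪basis H i, (Λ * ρ) (basis H i)⟫_ℂ) (trace (Λ * ρ)) := by
  have e : Λ * ρ = star (CFC.sqrt ρ * star Λ) * CFC.sqrt ρ := by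
    rw [star_mul, star_sqrt, star_star, mul_assoc, CFC.sqrt_mul_sqrt_self ρ]
  have h := hasSum_inner_star_mul (basis H) (hsSq_mul_ne_top_right hρ' (star Λ)) hρ'
  rw [← e] at h
  exact h.summable.hasSum

theorem hsSq_sqrt_posPart {ρ σ Λ : H →L[ℂ] H} {p q : ℝ} (hρ : 0 ≤ ρ) (hσ : 0 ≤ σ)
    (hρ' : hsSq (CFC.sqrt ρ) ≠ ⊤) (hσ' : hsSq (CFC.sqrt σ) ≠ ⊤)
    (hΛ : Λ * (p • ρ - q • σ) = (p • ρ - q • σ)⁺) :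
    hsSq (CFC.sqrt (p • ρ - q • σ)⁺) =
        ENNReal.ofReal (p * (trace (Λ * ρ)).re - q * (trace (Λ * σ)).re) ∧
      0 ≤ p * (trace (Λ * ρ)).re - q * (trace (Λ * σ)).re := by
  have hsum := ((Complex.hasSum_iff _ _).1 (hasSum_trace_mul hρ hρ' Λ)).1.mul_left p |>.sub
    (((Complex.hasSum_iff _ _).1 (hasSum_trace_mul hσ hσ' Λ)).1.mul_left q)
  have hterm (i : basisIndex H) : p * (⟪basis H i, (Λ * ρ) (basis H i)⟫_ℂ).re -
      q * (⟪basis H i, (Λ * σ) (basis H i)⟫_ℂ).re =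
        ‖CFC.sqrt (p • ρ - q • σ)⁺ (basis H i)‖ ^ 2 := by
    have h := inner_star_mul_self (CFC.sqrt (p • ρ - q • σ)⁺) (basis H i)
    rw [star_sqrt, CFC.sqrt_mul_sqrt_self _ (CFC.posPart_nonneg (p • ρ - q • σ)), ← hΛ] at h
    rw [← Complex.ofReal_re (‖CFC.sqrt (p • ρ - q • σ)⁺ (basis H i)‖ ^ 2), ← hΛ, ← h, mul_sub,
      mul_smul_comm, mul_smul_comm, sub_apply, smul_apply, smul_apply, inner_sub_right,
      ← Complex.coe_smul, ← Complex.coe_smul, inner_smul_right, inner_smul_right,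
      Complex.sub_re, Complex.re_ofReal_mul, Complex.re_ofReal_mul]
  simp only [hterm] at hsum
  refine ⟨?_, hsum.nonneg fun _ => by positivity⟩
  rw [← hsum.tsum_eq, ENNReal.ofReal_tsum_of_nonneg (fun _ => by positivity) hsum.summable]
  exact tsum_congr fun i => enorm_sq_eq_ofReal _

theorem hsSq_smul_rpow_mul_smul_rpow {ρ σ : H →L[ℂ] H} {p q s : ℝ} (hp : 0 ≤ p) (hq : 0 ≤ q)
    (hρ : 0 ≤ ρ) (hσ : 0 ≤ σ) (hρ' : hsSq (CFC.sqrt ρ) ≠ ⊤) (hσ' : hsSq (CFC.sqrt σ) ≠ ⊤)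
    (hs : s ∈ Set.Icc (0 : ℝ) 1) :
    hsSq (CFC.sqrt ((q • σ) ^ (1 - s)) * CFC.sqrt ((p • ρ) ^ s)) =
      ENNReal.ofReal (p ^ s * q ^ (1 - s) *
        (hsSq (CFC.sqrt (ρ ^ s) * CFC.sqrt (σ ^ (1 - s)))).toReal) := by
  have hs0 := hs.1
  have hs1 : 0 ≤ 1 - s := sub_nonneg.2 hs.2
  have hfin : hsSq (CFC.sqrt (ρ ^ s) * CFC.sqrt (σ ^ (1 - s))) ≠ ⊤ := by
    rw [sqrt_rpow_of_nonneg ρ hs0, sqrt_rpow_of_nonneg σ hs1]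
    exact hsSq_rpow_mul_rpow_ne_top hρ hσ hρ' hσ' (by linarith) (by linarith) (by ring)
  have hps := Real.rpow_nonneg hp s
  have hqs := Real.rpow_nonneg hq (1 - s)
  have hρs : 0 ≤ ρ ^ s := CFC.rpow_nonneg
  have hσs : 0 ≤ σ ^ (1 - s) := CFC.rpow_nonneg
  rw [real_smul_rpow hσ hσ' hq hs1, real_smul_rpow hρ hρ' hp hs0]
  generalize ρ ^ s = ρ₁ at *
  generalize σ ^ (1 - s) = σ₁ at *
  rw [sqrt_real_smul hσs hqs, sqrt_real_smul hρs hps, smul_mul_assoc,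
    hsSq_sqrt_smul hqs, mul_smul_comm, hsSq_sqrt_smul hps, hsSq_sqrt_mul_sqrt_comm,
    ENNReal.ofReal_mul (by positivity), ENNReal.ofReal_mul hps, ENNReal.ofReal_toReal hfin]
  ring

/-- The single-copy achievability bound behind the quantum Chernoff bound. -/
theorem exists_test_le {ρ σ : H →L[ℂ] H} {p q s : ℝ} (hp : 0 ≤ p) (hq : 0 ≤ q) (hρ : 0 ≤ ρ)
    (hσ : 0 ≤ σ) (hρ' : hsSq (CFC.sqrt ρ) = 1) (hσ' : hsSq (CFC.sqrt σ) = 1)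
    (hs : s ∈ Set.Icc (0 : ℝ) 1) :
    ∃ Λ : H →L[ℂ] H, 0 ≤ Λ ∧ Λ ≤ 1 ∧
      p * (trace ((1 - Λ) * ρ)).re + q * (trace (Λ * σ)).re ≤
        p ^ s * q ^ (1 - s) * (hsSq (CFC.sqrt (ρ ^ s) * CFC.sqrt (σ ^ (1 - s)))).toReal := by
  have hρt : hsSq (CFC.sqrt ρ) ≠ ⊤ := by simp [hρ']
  have hσt : hsSq (CFC.sqrt σ) ≠ ⊤ := by simp [hσ']
  have hs0 := hs.1
  have hs1 : 0 ≤ 1 - s := sub_nonneg.2 hs.2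
  have hA : 0 ≤ p • ρ := smul_nonneg hp hρ
  have hB : 0 ≤ q • σ := smul_nonneg hq hσ
  have hA' : hsSq (CFC.sqrt (p • ρ)) = ENNReal.ofReal p := by
    rw [sqrt_real_smul hρ hp, hsSq_sqrt_smul hp, hρ', mul_one]
  have hB' : hsSq (CFC.sqrt (q • σ)) = ENNReal.ofReal q := by
    rw [sqrt_real_smul hσ hq, hsSq_sqrt_smul hq, hσ', mul_one]
  obtain ⟨Λ, hΛ, hΛ', hΛD⟩ := exists_effect_mul_eq_posPart (hA.isSelfAdjoint.sub hB.isSelfAdjoint)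
  refine ⟨Λ, hΛ, hΛ', ?_⟩
  obtain ⟨h₁, h₂, h₃⟩ := trace_effect hρ hρ' hΛ hΛ'
  obtain ⟨h₄, -, -⟩ := trace_effect hσ hσ' hΛ hΛ'
  obtain ⟨hpos, hnn⟩ := hsSq_sqrt_posPart hρ hσ hρt hσt hΛD
  -- The exponent 1 - s puts the power s on pρ. The left side then becomes p, while the test has
  -- error p - Tr D₊.
  have key := hsSq_sqrt_le_posPart_add hA hB (by simp [hB']) (s := 1 - s) ⟨hs1, by linarith⟩
  rw [hA', hpos, sub_sub_cancel, hsSq_smul_rpow_mul_smul_rpow hp hq hρ hσ hρt hσt hs] at key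
  have hR : 0 ≤ p ^ s * q ^ (1 - s) *
        (hsSq (CFC.sqrt (ρ ^ s) * CFC.sqrt (σ ^ (1 - s)))).toReal := by positivity
  rw [← ENNReal.ofReal_add hnn hR, ENNReal.ofReal_le_ofReal_iff (add_nonneg hnn hR)] at key
  rw [h₂]
  rw [h₁] at key
  have h₅ : p * (hsSq (CFC.sqrt Λ * CFC.sqrt ρ)).toReal +
      p * (hsSq (CFC.sqrt (1 - Λ) * CFC.sqrt ρ)).toReal = p := by
    rw [← mul_add, h₃, mul_one]
  linarith

end ChernoffTest

/-! ### From error bounds to bounds on the number of copies. -/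

section SampleComplexity

variable {H : Type u} [NormedAddCommGroup H] [InnerProductSpace ℂ H] [CompleteSpace H]
variable {ρ σ : H →L[ℂ] H} {p q ε : ℝ}

theorem IsState.hsSq_sqrt_ne_top (hρ : IsState ρ) : hsSq (CFC.sqrt ρ) ≠ ⊤ := by
  simp [hρ.hsSq_sqrt]

theorem IsState.hsSq_sqrt_opPower (hρ : IsState ρ) (n : ℕ) :
    hsSq (CFC.sqrt (opPower ρ n)) = 1 := by
  rw [QHT.hsSq_sqrt_opPower hρ.nonneg, hρ.hsSq_sqrt, one_pow]

/-- The tensor power of the optimal single-copy contraction is used on n copies; multiplicativity of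
the inner product turns its value into the n-th power. -/
theorem mul_fidelity_pow_le (hp : 0 ≤ p) (hq : 0 ≤ q) (hpq : p + q = 1) (hρ : IsState ρ)
    (hσ : IsState σ) (n : ℕ) {Λ : (tensorPower H n).carrier →L[ℂ] (tensorPower H n).carrier}
    (hΛ : 0 ≤ Λ) (hΛ' : Λ ≤ 1) :
    p * q * fidelity ρ σ ^ n ≤ errorProb p ρ q σ n Λ * (1 - errorProb p ρ q σ n Λ) := by
  have hR := hρ.hsSq_sqrt_ne_top
  have hS := hσ.hsSq_sqrt_ne_top
  obtain ⟨W, hW, hWf⟩ := exists_hsInner_eq_schattenNorm hR hS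
  have h := mul_norm_hsInner_sq_le hp hq hpq (opPower_nonneg hρ.nonneg n)
    (opPower_nonneg hσ.nonneg n) (hρ.hsSq_sqrt_opPower n) (hσ.hsSq_sqrt_opPower n) hΛ hΛ'
    (norm_opPower_le_one hW n)
  rw [sqrt_opPower hρ.nonneg, sqrt_opPower hσ.nonneg, ← opPower_mul,
    hsInner_opPower (hsSq_mul_ne_top_right hR W) hS, hWf, norm_pow, Complex.norm_real,
    Real.norm_of_nonneg ENNReal.toReal_nonneg, star_sqrt, ← pow_mul, mul_comm n, pow_mul] at h
  exact h

theorem fidelity_nonneg (ρ σ : H →L[ℂ] H) : 0 ≤ fidelity ρ σ := sq_nonneg _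

theorem fidelity_le_one (hρ : IsState ρ) (hσ : IsState σ) : fidelity ρ σ ≤ 1 := by
  have hR := hρ.hsSq_sqrt_ne_top
  have hS := hσ.hsSq_sqrt_ne_top
  obtain ⟨W, hW, hWf⟩ := exists_hsInner_eq_schattenNorm hR hS
  have h := norm_hsInner_le (hsSq_mul_ne_top_right hR W) hS
  have h1 := ENNReal.toReal_mono hR (hsSq_mul_le_of_norm_le_one_right (CFC.sqrt ρ) hW)
  rw [hρ.hsSq_sqrt, ENNReal.toReal_one] at h1
  rw [hWf, Complex.norm_real, Real.norm_of_nonneg ENNReal.toReal_nonneg, star_sqrt, hσ.hsSq_sqrt,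
    ENNReal.toReal_one, Real.sqrt_one, mul_one] at h
  exact pow_le_one₀ ENNReal.toReal_nonneg (h.trans (Real.sqrt_le_one.2 h1))

theorem errorProb_nonneg (hp : 0 ≤ p) (hq : 0 ≤ q) (hρ : IsState ρ)
    (hσ : IsState σ) (n : ℕ) {Λ : (tensorPower H n).carrier →L[ℂ] (tensorPower H n).carrier}
    (hΛ : 0 ≤ Λ) (hΛ' : Λ ≤ 1) : 0 ≤ errorProb p ρ q σ n Λ := by
  obtain ⟨-, h₁, -⟩ := trace_effect (opPower_nonneg hρ.nonneg n) (hρ.hsSq_sqrt_opPower n) hΛ hΛ'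
  obtain ⟨h₂, -, -⟩ := trace_effect (opPower_nonneg hσ.nonneg n) (hσ.hsSq_sqrt_opPower n) hΛ hΛ'
  rw [errorProb, h₁, h₂]
  positivity

theorem mul_fidelity_pow_le_of_optErrorProb_le (hp : 0 ≤ p) (hq : 0 ≤ q) (hpq : p + q = 1)
    (hρ : IsState ρ) (hσ : IsState σ) (hε : 0 ≤ ε) (hε' : ε < 1 / 2) {n : ℕ}
    (h : optErrorProb p ρ q σ n ≤ ε) : p * q * fidelity ρ σ ^ n ≤ ε * (1 - ε) := by
  refine le_of_forall_pos_le_add fun δ hδ => ?_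
  have : Nonempty {Λ : (tensorPower H n).carrier →L[ℂ] (tensorPower H n).carrier //
      0 ≤ Λ ∧ Λ ≤ 1} := ⟨⟨0, le_rfl, zero_le_one⟩⟩
  -- The cap 1/2 - ε keeps the near-optimal error below 1/2, where x(1 - x) increases with slope at
  -- most 1.
  have hδ' : 0 < min δ (1 / 2 - ε) := lt_min hδ (by linarith)
  obtain ⟨Λ, hΛ⟩ := exists_lt_of_ciInf_lt (h.trans_lt (lt_add_of_pos_right ε hδ'))
  have h₁ := mul_fidelity_pow_le hp hq hpq hρ hσ n Λ.2.1 Λ.2.2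
  have h₂ := min_le_left δ (1 / 2 - ε)
  have h₃ := min_le_right δ (1 / 2 - ε)
  have h₄ := errorProb_nonneg hp hq hρ hσ n Λ.2.1 Λ.2.2
  generalize errorProb p ρ q σ n Λ.1 = e at *
  generalize min δ (1 / 2 - ε) = δ' at *
  nlinarith

theorem sampleComplexity_eq_top_or (p : ℝ) (ρ : H →L[ℂ] H) (q : ℝ) (σ : H →L[ℂ] H) (ε : ℝ) :
    sampleComplexity p ρ q σ ε = ⊤ ∨ ∃ n : ℕ, 1 ≤ n ∧ optErrorProb p ρ q σ n ≤ ε ∧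
      sampleComplexity p ρ q σ ε = n := by
  by_cases hS : {n : ℕ | 1 ≤ n ∧ optErrorProb p ρ q σ n ≤ ε}.Nonempty
  · right
    obtain ⟨h₁, h₂⟩ := Nat.sInf_mem hS
    refine ⟨_, h₁, h₂, le_antisymm (iInf_le_of_le _ (iInf₂_le h₁ h₂)) ?_⟩
    exact le_iInf fun n => le_iInf₂ fun hn hn' => Nat.cast_le.2 (Nat.sInf_le ⟨hn, hn'⟩)
  · left
    simp only [sampleComplexity, iInf_eq_top]
    exact fun n hn hn' => (hS ⟨n, hn, hn'⟩).elim

theorem logDiv_of_pos {x : ℝ} (hx : 0 < x) (hε : 0 < ε) : logDiv x ε = Real.log (x / ε) := by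
  rw [logDiv, ← ENNReal.ofReal_div_of_pos hε, ENNReal.log_ofReal_of_pos (div_pos hx hε)]

theorem logDiv_zero {x : ℝ} (hx : 0 < x) : logDiv x 0 = ⊤ := by
  rw [logDiv, ENNReal.ofReal_zero, ENNReal.div_zero (by simpa using hx), ENNReal.log_top]

theorem logDiv_div_le {F : ℝ} (hpq : 0 < p * q) (hF : 0 ≤ F) (hF' : F ≤ 1) (hε : 0 ≤ ε) {n : ℕ}
    (h : p * q * F ^ n ≤ ε * (1 - ε)) :
    logDiv (p * q) ε / ((-Real.log F : ℝ) : EReal) ≤ ((n : ℝ) : EReal) := by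
  -- At F = 0 and F = 1 `Real.log` is 0 and `EReal` division by 0 gives 0, so the bound is trivial.
  rcases hF.eq_or_lt with rfl | hF0
  · simp
  rcases hF'.eq_or_lt with rfl | hF1
  · simp
  have hL : 0 < -Real.log F := neg_pos.2 (Real.log_neg hF0 hF1)
  have hpos : 0 < p * q * F ^ n := by positivity
  have hε0 : 0 < ε := by
    rcases hε.eq_or_lt with rfl | h0
    · simp at h
      linarith
    · exact h0
  have hlog : Real.log (p * q / ε) ≤ -Real.log F * n := by
    have h1 : p * q / ε * F ^ n ≤ 1 := by
      rw [div_mul_eq_mul_div, div_le_one hε0]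
      nlinarith
    have h2 := Real.log_nonpos (by positivity) h1
    rw [Real.log_mul (by positivity) (by positivity), Real.log_pow] at h2
    linarith
  rw [logDiv_of_pos hpq hε0, EReal.div_le_iff_le_mul (by exact_mod_cast hL) (EReal.coe_ne_top _)]
  exact_mod_cast hlog

theorem div_buresDist_le (hpq : 0 < p * q) (hρ : IsState ρ) (hσ : IsState σ) {n : ℕ} (hn : 1 ≤ n)
    (h : p * q * fidelity ρ σ ^ n ≤ ε * (1 - ε)) :
    (p * q - ε * (1 - ε)) / (p * q * buresDist ρ σ ^ 2) ≤ n := by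
  have hd : 0 ≤ buresDist ρ σ ^ 2 := sq_nonneg _
  have hB := one_sub_buresDist_sq_le hρ hσ
  rcases hd.eq_or_lt with h0 | h0
  · simp [← h0]
  have hn' : (1 : ℝ) ≤ n := by exact_mod_cast hn
  have key : 1 - n * buresDist ρ σ ^ 2 ≤ fidelity ρ σ ^ n := by
    -- Bernoulli with exponent 2n, since F is a square. If the base is negative, then d_B² > 2 and
    -- the left side is negative because n ≥ 1.
    by_cases h1 : 0 ≤ 1 - buresDist ρ σ ^ 2 / 2
    · have h2 := one_add_mul_le_pow (a := -(buresDist ρ σ ^ 2 / 2)) (by linarith) (2 * n)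
      have h3 : (1 - buresDist ρ σ ^ 2 / 2) ^ (2 * n) ≤ fidelity ρ σ ^ n := by
        rw [fidelity, ← pow_mul]
        exact pow_le_pow_left₀ h1 hB _
      rw [← sub_eq_add_neg] at h2
      push_cast at h2
      linarith
    · have := pow_nonneg (fidelity_nonneg ρ σ) n
      nlinarith
  rw [div_le_iff₀ (mul_pos hpq h0)]
  nlinarith [mul_le_mul_of_nonneg_left key hpq.le]

theorem norm_le_one_of_isState (hρ : IsState ρ) : ‖ρ‖ ≤ 1 := by
  have h := enorm_sq_le_hsSq (CFC.sqrt ρ)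
  rw [hρ.hsSq_sqrt, enorm_sq_eq_ofReal, ENNReal.ofReal_le_one] at h
  rw [← CFC.sqrt_mul_sqrt_self ρ hρ.nonneg]
  exact (norm_mul_le _ _).trans (by rwa [← sq])

theorem norm_rpow_le_one (hρ : IsState ρ) {s : ℝ} (hs : s ∈ Set.Icc (0 : ℝ) 1) :
    ‖ρ ^ s‖ ≤ 1 := by
  have h := (CStarAlgebra.norm_le_one_iff_of_nonneg ρ hρ.nonneg).1 (norm_le_one_of_isState hρ)
  rw [CStarAlgebra.norm_le_one_iff_of_nonneg _ CFC.rpow_nonneg, ← CFC.one_rpow (x := s)]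
  exact CFC.rpow_le_rpow hs h

/-- Fractional powers of states are contractions, so stripping them off √ρ and √σ only increases the
norm. The left side, Tr[ρσ], is thus a lower bound uniform in s. -/
theorem hsSq_sqrt_mul_sqrt_le (hρ : IsState ρ) (hσ : IsState σ) {s : ℝ}
    (hs : s ∈ Set.Icc (0 : ℝ) 1) :
    hsSq (CFC.sqrt ρ * CFC.sqrt σ) ≤ hsSq (CFC.sqrt (ρ ^ s) * CFC.sqrt (σ ^ (1 - s))) := by
  obtain ⟨hs0, hs1⟩ := hs
  rw [sqrt_rpow_of_nonneg ρ hs0, sqrt_rpow_of_nonneg σ (sub_nonneg.2 hs1)]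
  have e1 : CFC.sqrt ρ = ρ ^ ((1 - s) / 2) * ρ ^ (s / 2) := by
    rw [← rpow_add_of_nonneg ρ (by linarith) (by linarith), CFC.sqrt_eq_rpow]
    congr 1
    ring
  have e2 : CFC.sqrt σ = σ ^ ((1 - s) / 2) * σ ^ (s / 2) := by
    rw [← rpow_add_of_nonneg σ (by linarith) (by linarith), CFC.sqrt_eq_rpow]
    congr 1
    ring
  have h1 : ‖ρ ^ ((1 - s) / 2)‖ ≤ 1 := norm_rpow_le_one hρ ⟨by linarith, by linarith⟩
  have h2 : ‖σ ^ (s / 2)‖ ≤ 1 := norm_rpow_le_one hσ ⟨by linarith, by linarith⟩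
  rw [e1, e2, mul_assoc, ← mul_assoc (ρ ^ (s / 2))]
  exact (hsSq_mul_le_of_norm_le_one_left h1 _).trans (hsSq_mul_le_of_norm_le_one_right _ h2)

theorem hsSq_sqrt_mul_sqrt_ne_zero (hρ : IsState ρ) (hσ : IsState σ) (h : ρ * σ ≠ 0) :
    hsSq (CFC.sqrt ρ * CFC.sqrt σ) ≠ 0 := by
  intro h0
  have h1 := enorm_sq_le_hsSq (CFC.sqrt ρ * CFC.sqrt σ)
  rw [h0, nonpos_iff_eq_zero, sq_eq_zero_iff, enorm_eq_zero] at h1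
  apply h
  rw [← CFC.sqrt_mul_sqrt_self ρ hρ.nonneg, ← CFC.sqrt_mul_sqrt_self σ hσ.nonneg, mul_assoc,
    ← mul_assoc (CFC.sqrt ρ) (CFC.sqrt σ), h1, zero_mul, mul_zero]

theorem hsSq_sqrt_opPower_mul {A B : H →L[ℂ] H} (hA : 0 ≤ A) (hB : 0 ≤ B) (n : ℕ) :
    hsSq (CFC.sqrt (opPower A n) * CFC.sqrt (opPower B n)) =
      hsSq (CFC.sqrt A * CFC.sqrt B) ^ n := by
  rw [sqrt_opPower hA, sqrt_opPower hB, ← opPower_mul, hsSq_opPower]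

theorem hsSq_opPower_rpow (hρ : IsState ρ) (hσ : IsState σ) {s t : ℝ} (hs : 0 ≤ s) (ht : 0 ≤ t)
    (n : ℕ) : hsSq (CFC.sqrt (opPower ρ n ^ s) * CFC.sqrt (opPower σ n ^ t)) =
      hsSq (CFC.sqrt (ρ ^ s) * CFC.sqrt (σ ^ t)) ^ n := by
  have h₁ : 0 ≤ ρ ^ s := CFC.rpow_nonneg
  have h₂ : 0 ≤ σ ^ t := CFC.rpow_nonneg
  rw [opPower_rpow hρ.nonneg hρ.hsSq_sqrt_ne_top hs, opPower_rpow hσ.nonneg hσ.hsSq_sqrt_ne_top ht,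
    hsSq_sqrt_opPower_mul h₁ h₂]

theorem optErrorProb_le (hp : 0 ≤ p) (hq : 0 ≤ q) (hρ : IsState ρ) (hσ : IsState σ) {s : ℝ}
    (hs : s ∈ Set.Icc (0 : ℝ) 1) (n : ℕ) :
    optErrorProb p ρ q σ n ≤
      p ^ s * q ^ (1 - s) * (hsSq (CFC.sqrt (ρ ^ s) * CFC.sqrt (σ ^ (1 - s)))).toReal ^ n := by
  have hs1 : 0 ≤ 1 - s := sub_nonneg.2 hs.2
  obtain ⟨Λ, hΛ, hΛ', h⟩ := exists_test_le hp hq (opPower_nonneg hρ.nonneg n)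
    (opPower_nonneg hσ.nonneg n) (hρ.hsSq_sqrt_opPower n) (hσ.hsSq_sqrt_opPower n) hs
  rw [hsSq_opPower_rpow hρ hσ hs.1 hs1, ENNReal.toReal_pow] at h
  refine (ciInf_le ⟨0, ?_⟩ (⟨Λ, hΛ, hΛ'⟩ : {Λ : (tensorPower H n).carrier →L[ℂ]
    (tensorPower H n).carrier // 0 ≤ Λ ∧ Λ ≤ 1})).trans h
  rintro _ ⟨Λ', rfl⟩
  exact errorProb_nonneg hp hq hρ hσ n Λ'.2.1 Λ'.2.2

/-- A Chernoff ratio below `M` yields `p^s q^(1-s) t^M < ε`, where `t = Tr[ρ^s σ^(1-s)]`. -/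
theorem mul_rpow_lt_of_chernoffRatio_lt (hε : 0 < ε) {s M c : ℝ}
    (hx : ε < p ^ s * q ^ (1 - s)) (hc : 0 < c)
    (hct : c ≤ (trace (ρ ^ s * σ ^ (1 - s))).re)
    (h : chernoffRatio p ρ q σ ε s < ENNReal.ofReal M) :
    p ^ s * q ^ (1 - s) * (trace (ρ ^ s * σ ^ (1 - s))).re ^ M < ε := by
  have hx0 := hε.trans hx
  rw [chernoffRatio, logDiv_of_pos hx0 hε, EReal.real_coe_toENNReal] at h
  generalize (trace (ρ ^ s * σ ^ (1 - s))).re = t at *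
  generalize p ^ s * q ^ (1 - s) = x at *
  have ht : 0 < t := hc.trans_le hct
  have ha : 0 < Real.log (x / ε) := Real.log_pos ((one_lt_div hε).2 hx)
  have hL : 0 < -Real.log t := by
    by_contra! hL
    -- A nonpositive denominator is truncated to 0, making the ratio infinite, which `h` forbids.
    rw [ENNReal.ofReal_of_nonpos hL, ENNReal.div_zero (by simpa using ha)] at h
    exact not_top_lt h
  rw [← ENNReal.ofReal_div_of_pos hL, ENNReal.ofReal_lt_ofReal_iff_of_nonneg (by positivity),
    div_lt_iff₀ hL] at h
  have hM := Real.rpow_pos_of_pos ht M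
  rw [← Real.log_lt_log_iff (mul_pos hx0 hM) hε, Real.log_mul hx0.ne' hM.ne', Real.log_rpow ht]
  rw [Real.log_div hx0.ne' hε.ne'] at h
  linarith

theorem optErrorProb_le_of_iInf_le (hp : 0 ≤ p) (hq : 0 ≤ q) (hρ : IsState ρ) (hσ : IsState σ)
    (hρσ : ρ * σ ≠ 0) (hε : 0 ≤ ε) (hx : ∀ s ∈ Set.Icc (0 : ℝ) 1, ε < p ^ s * q ^ (1 - s)) {N : ℕ}
    (hN : ⨅ s ∈ Set.Icc (0 : ℝ) 1, chernoffRatio p ρ q σ ε s ≤ N) :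
    optErrorProb p ρ q σ N ≤ ε := by
  have hlt (δ : ℝ) (hδ : 0 < δ) : ∃ s ∈ Set.Icc (0 : ℝ) 1,
      chernoffRatio p ρ q σ ε s < ENNReal.ofReal (N + δ) := by
    have : ⨅ s ∈ Set.Icc (0 : ℝ) 1, chernoffRatio p ρ q σ ε s < ENNReal.ofReal (N + δ) := by
      refine hN.trans_lt ?_
      rw [← ENNReal.ofReal_natCast]
      exact (ENNReal.ofReal_lt_ofReal_iff_of_nonneg (by positivity)).2 (by linarith)
    simpa only [iInf_lt_iff, exists_prop] using this
  rcases hε.eq_or_lt with rfl | hε0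
  -- For ε = 0 every ratio is infinite, contradicting `hN`.
  · obtain ⟨s, hs, h⟩ := hlt 1 one_pos
    rw [chernoffRatio, logDiv_zero (hx s hs), EReal.toENNReal_top,
      ENNReal.top_div_of_ne_top ENNReal.ofReal_ne_top] at h
    exact (not_top_lt h).elim
  set c := (hsSq (CFC.sqrt ρ * CFC.sqrt σ)).toReal with hc
  have hcfin : hsSq (CFC.sqrt ρ * CFC.sqrt σ) ≠ ⊤ :=
    hsSq_mul_ne_top_left _ hσ.hsSq_sqrt_ne_top
  have hc0 : 0 < c := ENNReal.toReal_pos (hsSq_sqrt_mul_sqrt_ne_zero hρ hσ hρσ) hcfin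
  -- The infimum need not be attained: a ratio below N + δ costs a factor t^(-δ) ≤ c^(-δ), which is
  -- uniform in s and tends to 1 as δ → 0.
  have hbound (δ : ℝ) (hδ : 0 < δ) : optErrorProb p ρ q σ N ≤ ε * c ^ (-δ) := by
    obtain ⟨s, hs, h⟩ := hlt δ hδ
    have htr := trace_rpow_mul_rpow hρ.nonneg hσ.nonneg hρ.hsSq_sqrt_ne_top
      hσ.hsSq_sqrt_ne_top hs
    have hfin : hsSq (CFC.sqrt (ρ ^ s) * CFC.sqrt (σ ^ (1 - s))) ≠ ⊤ := by
      rw [sqrt_rpow_of_nonneg ρ hs.1, sqrt_rpow_of_nonneg σ (sub_nonneg.2 hs.2)]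
      exact hsSq_rpow_mul_rpow_ne_top hρ.nonneg hσ.nonneg hρ.hsSq_sqrt_ne_top
        hσ.hsSq_sqrt_ne_top (by linarith [hs.1]) (by linarith [hs.2]) (by ring)
    have hct := ENNReal.toReal_mono hfin (hsSq_sqrt_mul_sqrt_le hρ hσ hs)
    have hopt := optErrorProb_le hp hq hρ hσ hs N
    have hre : (trace (ρ ^ s * σ ^ (1 - s))).re =
        (hsSq (CFC.sqrt (ρ ^ s) * CFC.sqrt (σ ^ (1 - s)))).toReal := by
      rw [htr, Complex.ofReal_re]
    have key := mul_rpow_lt_of_chernoffRatio_lt hε0 (hx s hs) hc0 (hct.trans_eq hre.symm) h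
    rw [hre] at key
    generalize (hsSq (CFC.sqrt (ρ ^ s) * CFC.sqrt (σ ^ (1 - s)))).toReal = t at *
    have ht : 0 < t := hc0.trans_le hct
    have htδ : t ^ (-δ) ≤ c ^ (-δ) := Real.rpow_le_rpow_of_nonpos hc0 hct (by linarith)
    calc optErrorProb p ρ q σ N ≤ p ^ s * q ^ (1 - s) * t ^ N := hopt
      _ = p ^ s * q ^ (1 - s) * t ^ ((N : ℝ) + δ) * t ^ (-δ) := by
        rw [mul_assoc _ (t ^ ((N : ℝ) + δ)), ← Real.rpow_add ht, add_neg_cancel_right,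
          Real.rpow_natCast]
      _ ≤ ε * c ^ (-δ) := by gcongr
  have hlim : Filter.Tendsto (fun δ : ℝ => ε * c ^ (-δ)) (nhdsWithin 0 (Set.Ioi 0)) (nhds ε) := by
    have hcont : Continuous fun δ : ℝ => ε * c ^ (-δ) :=
      continuous_const.mul (continuous_const.rpow continuous_neg fun _ => Or.inl hc0.ne')
    have := hcont.tendsto 0
    simp only [neg_zero, Real.rpow_zero, mul_one] at this
    exact this.mono_left nhdsWithin_le_nhds
  exact ge_of_tendsto hlim (Filter.eventually_of_mem self_mem_nhdsWithin hbound)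

end SampleComplexity

end QHT

end

theorem theorem2 {H : Type*} [NormedAddCommGroup H] [InnerProductSpace ℂ H] [CompleteSpace H]
    [TopologicalSpace.SeparableSpace H]
    (p q ε : ℝ) (hp : p ∈ Set.Ioo (0 : ℝ) 1) (hq : q = 1 - p) (hε : ε ∈ Set.Icc (0 : ℝ) 1)
    (ρ σ : H →L[ℂ] H) (hρ : QHT.IsState ρ) (hσ : QHT.IsState σ)
    (hnt : ¬ QHT.IsTrivialCase p ρ q σ ε) :
    max (QHT.logDiv (p * q) ε / ((-Real.log (QHT.fidelity ρ σ) : ℝ) : EReal))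
        (((p * q - ε * (1 - ε)) / (p * q * QHT.buresDist ρ σ ^ 2) : ℝ) : EReal)
      ≤ ((QHT.sampleComplexity p ρ q σ ε : ℝ≥0∞) : EReal) ∧
    QHT.sampleComplexity p ρ q σ ε
      ≤ ENat.ceil (⨅ s ∈ Set.Icc (0 : ℝ) 1, QHT.chernoffRatio p ρ q σ ε s) := by
  obtain ⟨hp0, hp1⟩ := hp
  have hq0 : 0 < q := by linarith
  have hpq : p + q = 1 := by linarith
  have hρσ : ρ * σ ≠ 0 := fun h => hnt (Or.inl h)
  have hε2 : ε < 1 / 2 := by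
    by_contra! h
    exact hnt (Or.inr (Or.inl ⟨h, hε.2⟩))
  have hx : ∀ s ∈ Set.Icc (0 : ℝ) 1, ε < p ^ s * q ^ (1 - s) := by
    intro s hs
    by_contra! h
    exact hnt (Or.inr (Or.inr (Or.inl ⟨s, hs, h⟩)))
  -- The endpoints s = 1 and s = 0 of the third condition.
  have hεp : ε < p := by simpa using hx 1 (by simp)
  have hεq : ε < q := by simpa using hx 0 (by simp)
  constructor
  · rcases QHT.sampleComplexity_eq_top_or p ρ q σ ε with h | ⟨n, hn, hopt, h⟩
    · rw [h]
      simp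
    · have key := QHT.mul_fidelity_pow_le_of_optErrorProb_le hp0.le hq0.le hpq hρ hσ hε.1 hε2 hopt
      have hcast : (((n : ℕ∞) : ℝ≥0∞) : EReal) = ((n : ℝ) : EReal) := by
        rw [ENat.toENNReal_coe]
        rfl
      rw [h, hcast]
      refine max_le (QHT.logDiv_div_le (mul_pos hp0 hq0) (QHT.fidelity_nonneg ρ σ)
        (QHT.fidelity_le_one hρ hσ) hε.1 key) ?_
      exact EReal.coe_le_coe_iff.2 (QHT.div_buresDist_le (mul_pos hp0 hq0) hρ hσ hn key)
  · set I := ⨅ s ∈ Set.Icc (0 : ℝ) 1, QHT.chernoffRatio p ρ q σ ε s with hI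
    rcases eq_or_ne (ENat.ceil I) ⊤ with htop | htop
    · rw [htop]
      exact le_top
    · obtain ⟨N, hN⟩ := ENat.ne_top_iff_exists.1 htop
      have hIN : I ≤ N := by
        have := ENat.le_ceil_self (r := I)
        rw [← hN] at this
        simpa using this
      have hopt := QHT.optErrorProb_le_of_iInf_le hp0.le hq0.le hρ hσ hρσ hε.1 hx hIN
      -- The sample complexity only counts n ≥ 1. A zero ceiling would give p q ≤ ε(1 - ε), contrary
      -- to (p - ε)(q - ε) > 0 and p + q = 1.
      have hN1 : 1 ≤ N := by
        by_contra! h0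
        obtain rfl : N = 0 := by omega
        have key := QHT.mul_fidelity_pow_le_of_optErrorProb_le hp0.le hq0.le hpq hρ hσ hε.1 hε2
          hopt
        rw [pow_zero, mul_one] at key
        nlinarith [mul_pos (sub_pos.2 hεp) (sub_pos.2 hεq)]
      rw [← hN]
      exact iInf_le_of_le N (iInf₂_le hN1 hopt)
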